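/- **Theorem 3.2 (energy dissipation for the $a_0$ scheme).** Let $d\in\{2,3\}$, let $\mathcal D\subset\mathbb R^d$ be a bounded open set, let $V\in L^\infty(\mathcal D;\mathbb R_{\ge 0})$, $\beta\ge 0$ and $\Omega\ge 0$, and assume that there is a constant $K>0$ with $V(r)\ge\frac{1+K}{4}\Omega^2(x^2+y^2)$ for almost every $r\in\mathcal D$, where $x,y$ are the first two coordinates of $r$. All functions are complex valued. Write $(v,w)_{L^2}=\int_{\mathcal D}\bar v w\,dr$, $L_z=-\mathrm i(x\partial_y-y\partial_x)$, $\|v\|_{H_0^1}=\|\nabla v\|_{L^2}$, let $\mathcal M=\{u\in H_0^1(\mathcal D;\mathbb C):\|u\|_{L^2}=1\}$, and for $u,v,w\in H_0^1(\mathcal D;\mathbb C)$ put $$E(u)=\int_{\mathcal D}\Big(\tfrac12|\nabla u|^2+\tfrac12V|u|^2+\tfrac\beta4|u|^4-\tfrac\Omega2\,\bar u L_zu\Big)dr,$$ $$(v,w)_{a_0}=\int_{\mathcal D}\big(\nabla\bar v\cdot\nabla w+V\bar vw-\Omega\,\bar vL_zw\big)dr,\qquad \|v\|_{a_0}=\sqrt{(v,v)_{a_0}}.$$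 Let $\nabla_{a_0}E(u)\in H_0^1(\mathcal D;\mathbb C)$ be the Sobolev gradient, given by $\Re(\nabla_{a_0}E(u),h)_{a_0}=\langle E'(u),h\rangle$ for all $h\in H_0^1(\mathcal D;\mathbb C)$, where $E'(u)$ is the real Fréchet derivative of $E$; let $\mathcal G_{a_0}w\in H_0^1(\mathcal D;\mathbb C)$ be given by $(\mathcal G_{a_0}w,h)_{a_0}=(w,h)_{L^2}$ for all $h\in H_0^1(\mathcal D;\mathbb C)$; and let $$\nabla^{\mathcal R}_{a_0}E(u)=\nabla_{a_0}E(u)-\frac{\Re(\nabla_{a_0}E(u),\mathcal G_{a_0}u)_{a_0}}{\|\mathcal G_{a_0}u\|_{a_0}^2}\,\mathcal G_{a_0}u$$ be the projected gradient. Let $R(v)=v/\|v\|_{L^2}$ for $v\ne0$. Then for every $\rho$ there exist positive constants $C_u$, $C_g$ and $C_\alpha\le1$, depending only on $\mathcal D$, $d$, $\beta$, $V$, $\Omega$ and $\rho$, such that the following holds for all $u_0\in\mathcal M$ with $\|u_0\|_{H_0^1}=\rho$ and all step sizes with $0<\alpha_{\min}\le\alpha_n\le\alpha_{\max}\le C_\alpha$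 $(n\ge0)$. The iterates $u_{n+1}=R\big(u_n-\alpha_n\nabla^{\mathcal R}_{a_0}E(u_n)\big)$ satisfy, for every $n\ge0$, 1. $\|u_n\|_{a_0}\le C_u$; 2. $\|\nabla^{\mathcal R}_{a_0}E(u_n)\|_{a_0}\le\|\nabla_{a_0}E(u_n)\|_{a_0}\le C_g$; 3. $E(u_n)-E(u_{n+1})\ge\frac{\alpha_{\min}}2\|\nabla^{\mathcal R}_{a_0}E(u_n)\|_{a_0}^2$. -/

import Mathlib

open MeasureTheory
open scoped ContDiff ENNReal

noncomputable section

namespace GrossPitaevskii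

/-- The complex space `L²(D; ℂ)` for a set `D ⊆ ℝ^d`. Mathlib's inner product on it is
`(v, w) = ∫_D conj v * w`, conjugate-linear in the first argument. -/
abbrev L2 {d : ℕ} (D : Set (EuclideanSpace ℝ (Fin d))) : Type :=
  Lp ℂ 2 (volume.restrict D)

/-- The Hilbert space `L²(D; ℂ) × L²(D; ℂ)^d`, whose squared norm is `‖p‖² + ∑ j, ‖q j‖²`. Pairs
`(u, ∇u)` live here, and their norm is the full `H¹` norm of `u`. -/
abbrev L2Pairs {d : ℕ} (D : Set (EuclideanSpace ℝ (Fin d))) : Type :=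
  WithLp 2 (L2 D × PiLp 2 (fun _ : Fin d => L2 D))

/-- The partial derivative `∂_j φ` of a differentiable function. -/
def partialDeriv {d : ℕ} (j : Fin d) (φ : EuclideanSpace ℝ (Fin d) → ℂ)
    (x : EuclideanSpace ℝ (Fin d)) : ℂ :=
  fderiv ℝ φ x (EuclideanSpace.single j 1)

/-- The pairs `(φ, ∇φ)` with `φ ∈ C_c^∞(D; ℂ)`. -/
def testPairs {d : ℕ} (D : Set (EuclideanSpace ℝ (Fin d))) : Submodule ℂ (L2Pairs D) where
  carrier := {p | ∃ φ : EuclideanSpace ℝ (Fin d) → ℂ,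
    ContDiff ℝ ∞ φ ∧ HasCompactSupport φ ∧ tsupport φ ⊆ D ∧
    (p.fst : EuclideanSpace ℝ (Fin d) → ℂ) =ᵐ[volume.restrict D] φ ∧
    ∀ j, (p.snd j : EuclideanSpace ℝ (Fin d) → ℂ) =ᵐ[volume.restrict D] partialDeriv j φ}
  zero_mem' := by
    refine ⟨fun _ => 0, contDiff_const, HasCompactSupport.zero, ?_, ?_, fun j => ?_⟩
    · simp [tsupport]
    · exact Lp.coeFn_zero ℂ 2 _
    · filter_upwards [Lp.coeFn_zero ℂ 2 (volume.restrict D)] with x hx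
      simpa [partialDeriv] using hx
  add_mem' := by
    rintro p q ⟨φ, hφ, hφc, hφs, hp, hp'⟩ ⟨ψ, hψ, hψc, hψs, hq, hq'⟩
    refine ⟨φ + ψ, hφ.add hψ, hφc.add hψc, ?_, ?_, fun j => ?_⟩
    · exact (tsupport_add φ ψ).trans (Set.union_subset hφs hψs)
    · exact (Lp.coeFn_add p.fst q.fst).trans (hp.add hq)
    · refine (Lp.coeFn_add (p.snd j) (q.snd j)).trans (((hp' j).add (hq' j)).trans ?_)
      refine Filter.Eventually.of_forall fun x => ?_
      simp only [partialDeriv, Pi.add_apply]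
      rw [fderiv_add (hφ.differentiable (by simp) x) (hψ.differentiable (by simp) x)]
      rfl
  smul_mem' := by
    rintro c p ⟨φ, hφ, hφc, hφs, hp, hp'⟩
    refine ⟨c • φ, hφ.const_smul c, hφc.smul_left (f := fun _ => c), ?_, ?_, fun j => ?_⟩
    · exact (tsupport_smul_subset_right (fun _ => c) φ).trans hφs
    · exact (Lp.coeFn_smul c p.fst).trans (hp.const_smul c)
    · refine (Lp.coeFn_smul c (p.snd j)).trans (((hp' j).const_smul c).trans ?_)
      refine Filter.Eventually.of_forall fun x => ?_
      simp only [partialDeriv, Pi.smul_apply]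
      rw [fderiv_const_smul (hφ.differentiable (by simp) x)]
      rfl

/-- The Sobolev space `H_0^1(D; ℂ)`: the closure of `C_c^∞(D; ℂ)` in the `H¹` norm. An element is
stored together with its weak gradient, as the pair `(u, ∇u)`; the norm that Mathlib puts on this
type is the full `H¹` norm. -/
abbrev H01 {d : ℕ} (D : Set (EuclideanSpace ℝ (Fin d))) : Type :=
  ↥(testPairs D).topologicalClosure

variable {d : ℕ} {D : Set (EuclideanSpace ℝ (Fin d))}

/-- The underlying `L²` function of `u ∈ H_0^1(D; ℂ)`. -/
def fn (u : H01 D) : L2 D := u.1.fst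

/-- The weak partial derivative `∂_j u` of `u ∈ H_0^1(D; ℂ)`. -/
def wd (j : Fin d) (u : H01 D) : L2 D := u.1.snd j

/-- The norm `‖u‖_{H_0^1} = ‖∇u‖_{L²}` of `H_0^1(D; ℂ)`. -/
def normH01 (u : H01 D) : ℝ := Real.sqrt (∑ j, ‖wd j u‖ ^ 2)

/-- The angular momentum `L_z u = -i (x ∂_y u - y ∂_x u)`; the coordinates `x`, `y` have the
indices `0`, `1`. -/
def Lz [d.AtLeastTwo] (u : H01 D) (r : EuclideanSpace ℝ (Fin d)) : ℂ :=
  -Complex.I * ((r 0 : ℂ) * wd 1 u r - (r 1 : ℂ) * wd 0 u r)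

/-- The Gross-Pitaevskii energy
`E(u) = ∫_D (1/2 |∇u|² + 1/2 V |u|² + β/4 |u|⁴ - Ω/2 conj u * L_z u)`. (The integral of
`conj u * L_z u` is real for `u ∈ H_0^1`, so that only the real part of the integrand counts.) -/
def energy [d.AtLeastTwo] (V : EuclideanSpace ℝ (Fin d) → ℝ) (β Ω : ℝ) (u : H01 D) : ℝ :=
  ∫ r in D, (1 / 2 * ∑ j, ‖wd j u r‖ ^ 2 + 1 / 2 * V r * ‖fn u r‖ ^ 2 + β / 4 * ‖fn u r‖ ^ 4
    - Ω / 2 * (starRingEnd ℂ (fn u r) * Lz u r).re)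

/-- The inner product
`(v, w)_{a_0} = ∫_D (∇(conj v) · ∇w + V * conj v * w - Ω * conj v * L_z w)`. -/
def a0 [d.AtLeastTwo] (V : EuclideanSpace ℝ (Fin d) → ℝ) (Ω : ℝ) (v w : H01 D) : ℂ :=
  ∫ r in D, (∑ j, starRingEnd ℂ (wd j v r) * wd j w r
    + (V r : ℂ) * starRingEnd ℂ (fn v r) * fn w r
    - (Ω : ℂ) * starRingEnd ℂ (fn v r) * Lz w r)

/-- The norm `‖v‖_X = √(v, v)_X` of an inner product `X` on `H_0^1(D; ℂ)`. -/
def normX (X : H01 D → H01 D → ℂ) (v : H01 D) : ℝ := Real.sqrt (X v v).re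

open Classical in
/-- The Sobolev gradient `∇_X F(u)` of a functional `F` on `H_0^1(D; ℂ)`: the element with
`Re (∇_X F(u), h)_X = ⟨F'(u), h⟩` for all `h ∈ H_0^1`, where `F'(u)` is the real Fréchet
derivative. -/
def sobolevGrad (X : H01 D → H01 D → ℂ) (F : H01 D → ℝ) (u : H01 D) : H01 D :=
  if h : ∃ g : H01 D, ∀ v : H01 D, (X g v).re = fderiv ℝ F u v then h.choose else 0

open Classical in
/-- The solution operator `G_X`: `(G_X w, h)_X = (w, h)_{L²}` for all `h ∈ H_0^1`. -/
def solOp (X : H01 D → H01 D → ℂ) (w : L2 D) : H01 D :=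
  if h : ∃ g : H01 D, ∀ v : H01 D, X g v = inner ℂ w (fn v) then h.choose else 0

/-- The projection `P_{u,X} w = w - Re (w, G_X u)_X / ‖G_X u‖_X² * G_X u` onto the tangent space
`{v ∈ H_0^1 : Re (u, v)_{L²} = 0}`. -/
def tangentProj (X : H01 D → H01 D → ℂ) (u w : H01 D) : H01 D :=
  w - ((X w (solOp X (fn u))).re / normX X (solOp X (fn u)) ^ 2) • solOp X (fn u)

/-- The projected (Riemannian) gradient `∇^R_X F(u) = P_{u,X} (∇_X F(u))`. -/
def riemGrad (X : H01 D → H01 D → ℂ) (F : H01 D → ℝ) (u : H01 D) : H01 D :=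
  tangentProj X u (sobolevGrad X F u)

/-- The constraint manifold `{u ∈ H_0^1(D; ℂ) : ‖u‖_{L²} = 1}`. -/
def massSphere (D : Set (EuclideanSpace ℝ (Fin d))) : Set (H01 D) := {u | ‖fn u‖ = 1}

/-- The retraction `R(v) = v / ‖v‖_{L²}`, meant for `v ≠ 0`. -/
def retraction (v : H01 D) : H01 D := ‖fn v‖⁻¹ • v

end GrossPitaevskii

end

/-!
# Energy dissipation of the `a₀` Sobolev gradient scheme

In the inner product `a₀` the energy is `E(u) = 1/2 ‖u‖² + β/4 ∫ |u|⁴`, so everything follows from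
three facts about `a₀` on `H_0^1`. It is bounded, because the domain and the potential are. It is
Hermitian, because `L_z` is symmetric: on test functions this is integration by parts, where the
coordinate in front of a derivative does not depend on its direction (`inner_fn_LzL`). It is
coercive, because the lower bound on the potential absorbs the rotation term by Young's inequality
(`re_a0_self_ge`), and the gradient norm controls the full `H¹` norm by Poincaré's inequality.
Hence the Sobolev gradient and the solution operator exist (`exists_a0_eq`), and the Sobolev
embedding `H_0^1 → L⁴` (`exists_eLpNorm_le`, the Gagliardo–Nirenberg–Sobolev inequality for test
functions and Fatou's lemma) gives a constant `S` with `∫ |u|⁴ ≤ (S ‖u‖)⁴`.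

Expanding `|u + h|⁴` to second order shows that the energy is Fréchet differentiable and that
`E(u + h) - E(u) - E'(u) h - 1/2 ‖h‖²` is at most `β/4 S⁴ ‖h‖² (8 ‖u‖² + 3 ‖h‖²)`
(`abs_energy_add_sub_le`). Let `p` be the projected gradient at a point `u` of the mass sphere.
It is `a₀`-orthogonal to its difference from the gradient, so `E'(u) p = ‖p‖²`, and it is
`L²`-orthogonal to `u` (`tangentProj_spec`), so `u - α p` has `L²` norm at least one and its
normalization does not increase the energy (`energy_retraction_le`). With `h = -α p` the expansion
gives a decrease of at least `α ‖p‖² (1 - α (1/2 + M))`, where `M` depends on bounds for `‖u‖` and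
`‖p‖` only (`energy_step_le`). These bounds come from the energy, as `‖u‖² ≤ 2 E(u)`, and the
energy does not increase along the iteration; so one step size bound serves all steps.
-/

noncomputable section

namespace GrossPitaevskii

variable {d : ℕ} {D : Set (EuclideanSpace ℝ (Fin d))}

/-! ### The form `a₀` as a bounded operator on `H_0^1` -/

/-- The embedding `H_0^1 → L²` as a continuous linear map. -/
def fnL (D : Set (EuclideanSpace ℝ (Fin d))) : H01 D →L[ℂ] L2 D :=
  (WithLp.fstL 2 ℂ (L2 D) (PiLp 2 (fun _ : Fin d => L2 D))).comp
    (testPairs D).topologicalClosure.subtypeL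

/-- The weak partial derivative `∂_j : H_0^1 → L²` as a continuous linear map. -/
def wdL (D : Set (EuclideanSpace ℝ (Fin d))) (j : Fin d) : H01 D →L[ℂ] L2 D :=
  ((PiLp.proj 2 (fun _ : Fin d => L2 D) j).comp
    (WithLp.sndL 2 ℂ (L2 D) (PiLp 2 (fun _ : Fin d => L2 D)))).comp
    (testPairs D).topologicalClosure.subtypeL

@[simp] lemma fnL_apply (u : H01 D) : fnL D u = fn u := rfl

@[simp] lemma wdL_apply (j : Fin d) (u : H01 D) : wdL D j u = wd j u := rfl

lemma norm_sq_eq (u : H01 D) : ‖u‖ ^ 2 = ‖fn u‖ ^ 2 + ∑ j, ‖wd j u‖ ^ 2 := by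
  have h : ‖u‖ ^ 2 = ‖u.1‖ ^ 2 := rfl
  rw [h, WithLp.prod_norm_sq_eq_of_L2, PiLp.norm_sq_eq_of_L2]
  rfl

lemma normH01_sq (u : H01 D) : normH01 u ^ 2 = ∑ j, ‖wd j u‖ ^ 2 :=
  Real.sq_sqrt (by positivity)

lemma memLp_top_ofReal {m : EuclideanSpace ℝ (Fin d) → ℝ}
    (hm : MemLp m ∞ (volume.restrict D)) :
    MemLp (fun r => (m r : ℂ)) ∞ (volume.restrict D) := hm.ofReal

/-- Multiplication by an essentially bounded real function, as an operator on `L²`. -/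
def mulOp {m : EuclideanSpace ℝ (Fin d) → ℝ} (hm : MemLp m ∞ (volume.restrict D)) :
    L2 D →L[ℂ] L2 D :=
  (ContinuousLinearMap.mul ℂ ℂ).holderL (volume.restrict D) ∞ 2 2 (memLp_top_ofReal hm).toLp

lemma coeFn_mulOp {m : EuclideanSpace ℝ (Fin d) → ℝ} (hm : MemLp m ∞ (volume.restrict D))
    (f : L2 D) : mulOp hm f =ᵐ[volume.restrict D] fun r => (m r : ℂ) * f r := by
  have h1 := (ContinuousLinearMap.mul ℂ ℂ).coeFn_holder (r := 2) (memLp_top_ofReal hm).toLp f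
  have h2 := (memLp_top_ofReal hm).coeFn_toLp
  filter_upwards [h1, h2] with r h1 h2
  rw [← h2]
  exact h1

lemma memLp_coord (hDb : Bornology.IsBounded D) (i : Fin d) :
    MemLp (fun r : EuclideanSpace ℝ (Fin d) => r i) ∞ (volume.restrict D) := by
  obtain ⟨R, hR⟩ := hDb.exists_norm_le
  refine memLp_top_of_bound (by fun_prop) R ?_
  refine ae_restrict_of_ae_restrict_of_subset (t := {r | ‖r‖ ≤ R}) (fun r hr => hR r hr) ?_
  refine (ae_restrict_iff' (measurableSet_le (by fun_prop) (by fun_prop))).2 ?_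
  exact Filter.Eventually.of_forall fun r hr => (PiLp.norm_apply_le r i).trans hr

/-- The angular momentum operator `L_z : H_0^1 → L²` on a bounded domain. -/
def LzL [d.AtLeastTwo] (hDb : Bornology.IsBounded D) : H01 D →L[ℂ] L2 D :=
  (-Complex.I) • ((mulOp (memLp_coord hDb 0)).comp (wdL D 1) -
    (mulOp (memLp_coord hDb 1)).comp (wdL D 0))

lemma coeFn_LzL [d.AtLeastTwo] (hDb : Bornology.IsBounded D) (u : H01 D) :
    LzL hDb u =ᵐ[volume.restrict D] Lz u := by
  have h : LzL hDb u = (-Complex.I) • (mulOp (memLp_coord hDb 0) (wd 1 u) -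
    mulOp (memLp_coord hDb 1) (wd 0 u)) := rfl
  rw [h]
  filter_upwards [Lp.coeFn_smul (-Complex.I) (mulOp (memLp_coord hDb 0) (wd 1 u) -
    mulOp (memLp_coord hDb 1) (wd 0 u)), Lp.coeFn_sub (mulOp (memLp_coord hDb 0) (wd 1 u))
    (mulOp (memLp_coord hDb 1) (wd 0 u)), coeFn_mulOp (memLp_coord hDb 0) (wd 1 u),
    coeFn_mulOp (memLp_coord hDb 1) (wd 0 u)] with r h1 h2 h3 h4
  rw [h1, Pi.smul_apply, h2, Pi.sub_apply, h3, h4, Lz, smul_eq_mul]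

/-- The operator that represents the form
`(v, w) ↦ ∑ j, ⟪T j v, T j w⟫ + ⟪S v, M (S w)⟫ - c * ⟪S v, L w⟫` on a Hilbert space. -/
def formOp {E F ι : Type*} [NormedAddCommGroup E] [InnerProductSpace ℂ E] [CompleteSpace E]
    [NormedAddCommGroup F] [InnerProductSpace ℂ F] [CompleteSpace F] [Fintype ι]
    (T : ι → E →L[ℂ] F) (S L : E →L[ℂ] F) (M : F →L[ℂ] F) (c : ℂ) : E →L[ℂ] E :=
  ∑ j, (T j).adjoint.comp (T j) + S.adjoint.comp (M.comp S) - c • S.adjoint.comp L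

lemma inner_formOp {E F ι : Type*} [NormedAddCommGroup E] [InnerProductSpace ℂ E] [CompleteSpace E]
    [NormedAddCommGroup F] [InnerProductSpace ℂ F] [CompleteSpace F] [Fintype ι]
    (T : ι → E →L[ℂ] F) (S L : E →L[ℂ] F) (M : F →L[ℂ] F) (c : ℂ) (v w : E) :
    inner ℂ v (formOp T S L M c w) =
      ∑ j, inner ℂ (T j v) (T j w) + inner ℂ (S v) (M (S w)) - c * inner ℂ (S v) (L w) := by
  simp only [formOp, sub_apply, add_apply, sum_apply, smul_apply, ContinuousLinearMap.comp_apply,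
    inner_sub_right, inner_add_right, inner_sum, inner_smul_right,
    ContinuousLinearMap.adjoint_inner_right]

/-- The bounded operator `A` on `H_0^1` (with the full `H¹` inner product) that represents the
form `a₀`, in the sense that `(v, w)_{a₀} = ⟪v, A w⟫`. -/
def a0Op [d.AtLeastTwo] (hDb : Bornology.IsBounded D) {V : EuclideanSpace ℝ (Fin d) → ℝ}
    (hV : MemLp V ∞ (volume.restrict D)) (Ω : ℝ) : H01 D →L[ℂ] H01 D :=
  formOp (E := H01 D) (wdL D) (fnL D) (LzL hDb) (mulOp hV) Ω

lemma inner_a0Op [d.AtLeastTwo] (hDb : Bornology.IsBounded D) {V : EuclideanSpace ℝ (Fin d) → ℝ}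
    (hV : MemLp V ∞ (volume.restrict D)) (Ω : ℝ) (v w : H01 D) :
    inner ℂ v (a0Op hDb hV Ω w) = ∑ j, inner ℂ (wd j v) (wd j w)
      + inner ℂ (fn v) (mulOp hV (fn w)) - (Ω : ℂ) * inner ℂ (fn v) (LzL hDb w) := by
  have h := inner_formOp (E := H01 D) (wdL D) (fnL D) (LzL hDb) (mulOp hV) Ω v w
  simp only [fnL_apply, wdL_apply] at h
  exact h

lemma a0_integrand_eq [d.AtLeastTwo] (hDb : Bornology.IsBounded D)
    {V : EuclideanSpace ℝ (Fin d) → ℝ}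
    (hV : MemLp V ∞ (volume.restrict D)) (Ω : ℝ) (v w : H01 D) :
    (fun r => ∑ j, starRingEnd ℂ (wd j v r) * wd j w r
      + (V r : ℂ) * starRingEnd ℂ (fn v r) * fn w r
      - (Ω : ℂ) * starRingEnd ℂ (fn v r) * Lz w r) =ᵐ[volume.restrict D]
    fun r => ∑ j, inner ℂ (wd j v r) (wd j w r) + inner ℂ (fn v r) (mulOp hV (fn w) r)
      - (Ω : ℂ) * inner ℂ (fn v r) (LzL hDb w r) := by
  filter_upwards [coeFn_mulOp hV (fn w), coeFn_LzL hDb w] with r h1 h2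
  rw [h1, h2]
  simp only [RCLike.inner_apply]
  congr 1
  · congr 1
    · exact Finset.sum_congr rfl fun j _ => mul_comm _ _
    · ring
  · ring

lemma integrable_a0_integrand [d.AtLeastTwo] (hDb : Bornology.IsBounded D)
    {V : EuclideanSpace ℝ (Fin d) → ℝ}
    (hV : MemLp V ∞ (volume.restrict D)) (Ω : ℝ) (v w : H01 D) :
    Integrable (fun r => ∑ j, starRingEnd ℂ (wd j v r) * wd j w r
      + (V r : ℂ) * starRingEnd ℂ (fn v r) * fn w r
      - (Ω : ℂ) * starRingEnd ℂ (fn v r) * Lz w r) (volume.restrict D) := by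
  refine Integrable.congr ?_ (a0_integrand_eq hDb hV Ω v w).symm
  refine Integrable.sub (Integrable.add (integrable_finsetSum _ fun j _ => ?_) ?_) ?_
  · exact L2.integrable_inner _ _
  · exact L2.integrable_inner _ _
  · exact (L2.integrable_inner _ _).const_mul _

lemma a0_eq_inner [d.AtLeastTwo] (hDb : Bornology.IsBounded D)
    {V : EuclideanSpace ℝ (Fin d) → ℝ}
    (hV : MemLp V ∞ (volume.restrict D)) (Ω : ℝ) (v w : H01 D) :
    a0 V Ω v w = inner ℂ v (a0Op hDb hV Ω w) := by
  rw [inner_a0Op, a0, integral_congr_ae (a0_integrand_eq hDb hV Ω v w), integral_sub, integral_add,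
    integral_finsetSum, integral_const_mul]
  · simp only [L2.inner_def]
  · exact fun j _ => L2.integrable_inner _ _
  · exact integrable_finsetSum _ fun j _ => L2.integrable_inner _ _
  · exact L2.integrable_inner _ _
  · exact (integrable_finsetSum _ fun j _ => L2.integrable_inner _ _).add (L2.integrable_inner _ _)
  · exact (L2.integrable_inner _ _).const_mul _

lemma integrable_norm_sq (f : L2 D) : Integrable (fun r => ‖f r‖ ^ 2) (volume.restrict D) :=
  (Lp.memLp f).integrable_norm_pow (by norm_num)

lemma integral_norm_sq (f : L2 D) : ∫ r in D, ‖f r‖ ^ 2 = ‖f‖ ^ 2 := by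
  rw [← inner_self_eq_norm_sq (𝕜 := ℂ) f, L2.inner_def]
  simp_rw [inner_self_eq_norm_sq_to_K]
  have : ∀ r, ((‖f r‖ : ℂ)) ^ 2 = ((‖f r‖ ^ 2 : ℝ) : ℂ) := fun r => by push_cast; rfl
  simp only [Complex.coe_algebraMap, this]
  rw [integral_complex_ofReal]
  simp

lemma fin_zero_ne_one [d.AtLeastTwo] : (0 : Fin d) ≠ 1 := by
  have := Nat.AtLeastTwo.prop (n := d)
  intro h
  have := congrArg Fin.val h
  simp [Nat.mod_eq_of_lt (show 1 < d by omega)] at this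

/-- Pointwise Cauchy–Schwarz for the angular momentum: `|L_z u| ≤ (x² + y²)^{1/2} |∇u|`. -/
lemma norm_Lz_sq_le [d.AtLeastTwo] (u : H01 D) (r : EuclideanSpace ℝ (Fin d)) :
    ‖Lz u r‖ ^ 2 ≤ ((r 0) ^ 2 + (r 1) ^ 2) * ∑ j, ‖wd j u r‖ ^ 2 := by
  have h1 : ‖Lz u r‖ ≤ |r 0| * ‖wd 1 u r‖ + |r 1| * ‖wd 0 u r‖ := by
    rw [Lz, norm_mul, norm_neg, Complex.norm_I, one_mul]
    refine (norm_sub_le _ _).trans ?_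
    simp
  have h2 : ‖wd 0 u r‖ ^ 2 + ‖wd 1 u r‖ ^ 2 ≤ ∑ j, ‖wd j u r‖ ^ 2 := by
    rw [← Finset.sum_pair (f := fun j => ‖wd j u r‖ ^ 2) fin_zero_ne_one]
    exact Finset.sum_le_sum_of_subset_of_nonneg (Finset.subset_univ _) fun _ _ _ => by positivity
  have h3 : ‖Lz u r‖ ^ 2 ≤ (|r 0| * ‖wd 1 u r‖ + |r 1| * ‖wd 0 u r‖) ^ 2 := by gcongr
  refine h3.trans (le_trans ?_ (mul_le_mul_of_nonneg_left h2 (by positivity)))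
  nlinarith [sq_nonneg (|r 0| * ‖wd 0 u r‖ - |r 1| * ‖wd 1 u r‖), sq_abs (r 0), sq_abs (r 1)]

lemma re_a0_integrand [d.AtLeastTwo] (V : EuclideanSpace ℝ (Fin d) → ℝ) (Ω : ℝ) (u : H01 D)
    (r : EuclideanSpace ℝ (Fin d)) :
    (∑ j, starRingEnd ℂ (wd j u r) * wd j u r + (V r : ℂ) * starRingEnd ℂ (fn u r) * fn u r
      - (Ω : ℂ) * starRingEnd ℂ (fn u r) * Lz u r).re =
      ∑ j, ‖wd j u r‖ ^ 2 + V r * ‖fn u r‖ ^ 2 - Ω * (starRingEnd ℂ (fn u r) * Lz u r).re := by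
  simp only [mul_assoc, Complex.conj_mul', Complex.add_re, Complex.sub_re, Complex.re_sum,
    Complex.re_ofReal_mul, ← Complex.ofReal_pow, Complex.ofReal_re]

/-- Coercivity of `a₀` in the gradient norm. The rotation term is absorbed by Young's inequality,
`Ω |u| |L_z u| ≤ |∇u|² / (1 + K) + (1 + K) / 4 * Ω² (x² + y²) |u|²`. -/
lemma re_a0_self_ge [d.AtLeastTwo] (hDb : Bornology.IsBounded D)
    {V : EuclideanSpace ℝ (Fin d) → ℝ}
    (hV : MemLp V ∞ (volume.restrict D)) {Ω K : ℝ} (hK : 0 < K)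
    (hVΩ : ∀ᵐ r ∂(volume.restrict D),
      (1 + K) / 4 * Ω ^ 2 * ((r 0) ^ 2 + (r 1) ^ 2) ≤ V r) (u : H01 D) :
    K / (1 + K) * normH01 u ^ 2 ≤ (a0 V Ω u u).re := by
  have hi := integrable_a0_integrand hDb hV Ω u u
  have h1 : (a0 V Ω u u).re = ∫ r in D, (∑ j, starRingEnd ℂ (wd j u r) * wd j u r
      + (V r : ℂ) * starRingEnd ℂ (fn u r) * fn u r
      - (Ω : ℂ) * starRingEnd ℂ (fn u r) * Lz u r).re := by
    rw [a0]
    exact (integral_re hi).symm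
  have h2 : K / (1 + K) * normH01 u ^ 2 = ∫ r in D, K / (1 + K) * ∑ j, ‖wd j u r‖ ^ 2 := by
    rw [normH01_sq, integral_const_mul, integral_finsetSum _ fun j _ => integrable_norm_sq _]
    simp only [integral_norm_sq]
  rw [h1, h2]
  refine integral_mono_ae ((integrable_finsetSum _ fun j _ => integrable_norm_sq _).const_mul _)
    hi.re ?_
  filter_upwards [hVΩ] with r hr
  simp only [re_a0_integrand]
  set S := ∑ j, ‖wd j u r‖ ^ 2 with hS
  set s := (r 0) ^ 2 + (r 1) ^ 2
  have hs0 : 0 ≤ S := by positivity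
  have hL := norm_Lz_sq_le u r
  set a := ‖fn u r‖
  have h4 : |(starRingEnd ℂ (fn u r) * Lz u r).re| ≤ a * ‖Lz u r‖ := by
    refine (Complex.abs_re_le_norm _).trans ?_
    rw [norm_mul, RCLike.norm_conj]
  set b := ‖Lz u r‖
  have h5 : Ω * (starRingEnd ℂ (fn u r) * Lz u r).re ≤ |Ω| * (a * b) := by
    refine (le_abs_self _).trans ?_
    rw [abs_mul]
    gcongr
  have h6 : (|Ω| * (a * b)) ^ 2 ≤ (2 * ((1 / (1 + K)) * S)) *
      (2 * ((1 + K) / 4 * Ω ^ 2 * s * a ^ 2)) := by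
    have : |Ω| ^ 2 * a ^ 2 * b ^ 2 ≤ |Ω| ^ 2 * a ^ 2 * (s * S) := by gcongr
    have e : (2 * ((1 / (1 + K)) * S)) * (2 * ((1 + K) / 4 * Ω ^ 2 * s * a ^ 2)) =
        |Ω| ^ 2 * a ^ 2 * (s * S) := by
      rw [sq_abs]; field_simp; ring
    rw [e]
    linarith [this, (by ring : (|Ω| * (a * b)) ^ 2 = |Ω| ^ 2 * a ^ 2 * b ^ 2)]
  have hp : 0 ≤ 1 / (1 + K) * S := by positivity
  have hq : 0 ≤ (1 + K) / 4 * Ω ^ 2 * s * a ^ 2 := by positivity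
  have h7 : |Ω| * (a * b) ≤ 1 / (1 + K) * S + (1 + K) / 4 * Ω ^ 2 * s * a ^ 2 := by
    refine abs_le_of_sq_le_sq' ?_ (by positivity) |>.2
    nlinarith [sq_nonneg (1 / (1 + K) * S - (1 + K) / 4 * Ω ^ 2 * s * a ^ 2)]
  have h8 : (1 + K) / 4 * Ω ^ 2 * s * a ^ 2 ≤ V r * a ^ 2 := by gcongr
  have h9 : K / (1 + K) * S + 1 / (1 + K) * S = S := by field_simp; ring
  change K / (1 + K) * S ≤ S + V r * a ^ 2 - _
  linarith

/-! ### Symmetry of the angular momentum -/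

/-- Density of the test functions in `H_0^1`, as an induction principle for closed properties. -/
lemma forall_of_testPairs {P : H01 D → Prop} (hc : IsClosed {u | P u})
    (h : ∀ u : H01 D, u.1 ∈ testPairs D → P u) (u : H01 D) : P u := by
  have hu : u ∈ closure {w : H01 D | w.1 ∈ testPairs D} := by
    rw [closure_subtype]
    refine closure_mono ?_ u.2
    intro p hp
    exact ⟨⟨p, subset_closure hp⟩, hp, rfl⟩
  exact closure_minimal (fun w hw => h w hw) hc hu

lemma inner_mulOp_comm {m : EuclideanSpace ℝ (Fin d) → ℝ} (hm : MemLp m ∞ (volume.restrict D))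
    (f g : L2 D) : inner ℂ f (mulOp hm g) = inner ℂ (mulOp hm f) g := by
  rw [L2.inner_def, L2.inner_def]
  refine integral_congr_ae ?_
  filter_upwards [coeFn_mulOp hm f, coeFn_mulOp hm g] with r h1 h2
  rw [h1, h2]
  simp only [RCLike.inner_apply, map_mul, Complex.conj_ofReal]
  ring

lemma integral_conj_mul_coord_mul_partialDeriv {i j : Fin d} (hij : i ≠ j)
    {φ ψ : EuclideanSpace ℝ (Fin d) → ℂ} (hφ : ContDiff ℝ ∞ φ) (hφc : HasCompactSupport φ)
    (hψ : ContDiff ℝ ∞ ψ) :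
    ∫ x, starRingEnd ℂ (φ x) * (x i : ℂ) * partialDeriv j ψ x =
      -∫ x, starRingEnd ℂ (partialDeriv j φ x) * (x i : ℂ) * ψ x := by
  have hd1 : Differentiable ℝ φ := hφ.differentiable (by simp)
  have hd2 : Differentiable ℝ ψ := hψ.differentiable (by simp)
  have hcont1 : Continuous φ := hφ.continuous
  have hcont2 : Continuous ψ := hψ.continuous
  have hcd1 : Continuous (partialDeriv j φ) :=
    (hφ.continuous_fderiv (by simp)).clm_apply continuous_const
  have hcd2 : Continuous (partialDeriv j ψ) :=
    (hψ.continuous_fderiv (by simp)).clm_apply continuous_const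
  have hsd1 : HasCompactSupport (partialDeriv j φ) := by
    refine (hφc.fderiv (𝕜 := ℝ)).mono ?_
    intro x hx h0
    exact hx (by simp only [partialDeriv, h0]; rfl)
  have hf : ∀ x, HasFDerivAt (fun x : EuclideanSpace ℝ (Fin d) => starRingEnd ℂ (φ x) * (x i : ℂ))
      (starRingEnd ℂ (φ x) • (Complex.ofRealCLM.comp (EuclideanSpace.proj (𝕜 := ℝ) i)) +
        (x i : ℂ) • ((Complex.conjCLE : ℂ →L[ℝ] ℂ).comp (fderiv ℝ φ x))) x := by
    intro x
    refine HasFDerivAt.mul ?_ ?_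
    · exact ((Complex.conjCLE : ℂ →L[ℝ] ℂ).hasFDerivAt).comp x (hd1 x).hasFDerivAt
    · exact (Complex.ofRealCLM.comp (EuclideanSpace.proj (𝕜 := ℝ) i)).hasFDerivAt
  have hfv : ∀ x, fderiv ℝ (fun x : EuclideanSpace ℝ (Fin d) => starRingEnd ℂ (φ x) * (x i : ℂ)) x
      (EuclideanSpace.single j 1) = starRingEnd ℂ (partialDeriv j φ x) * (x i : ℂ) := by
    intro x
    rw [(hf x).fderiv]
    simp [partialDeriv, hij, mul_comm]
  have hconj : ∀ {f : EuclideanSpace ℝ (Fin d) → ℂ}, HasCompactSupport f →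
      HasCompactSupport fun x => starRingEnd ℂ (f x) := fun h => h.comp_left (map_zero _)
  have key := integral_mul_fderiv_eq_neg_fderiv_mul_of_integrable (μ := volume) (𝕜 := ℂ)
    (f := fun x : EuclideanSpace ℝ (Fin d) => starRingEnd ℂ (φ x) * (x i : ℂ)) (g := ψ)
    (v := EuclideanSpace.single j 1) ?_ ?_ ?_ (fun x _ => (hf x).differentiableAt)
    (fun x _ => hd2 x)
  · simp only [hfv] at key
    exact key
  · simp only [hfv]
    exact Continuous.integrable_of_hasCompactSupport (by fun_prop)
      ((hconj hsd1).mul_right.mul_right)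
  · exact Continuous.integrable_of_hasCompactSupport (Continuous.mul (by fun_prop) hcd2)
      ((hconj hφc).mul_right.mul_right)
  · exact Continuous.integrable_of_hasCompactSupport (by fun_prop)
      ((hconj hφc).mul_right.mul_right)

/-- Integration by parts in `H_0^1` against a coordinate that does not depend on the direction of
differentiation. -/
lemma inner_fn_coord_wd (hDb : Bornology.IsBounded D) {i j : Fin d} (hij : i ≠ j) (v w : H01 D) :
    inner ℂ (fn v) (mulOp (memLp_coord hDb i) (wd j w)) =
      -inner ℂ (wd j v) (mulOp (memLp_coord hDb i) (fn w)) := by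
  have hc1 : Continuous (fn : H01 D → L2 D) := (fnL D).continuous
  have hc2 : Continuous (wd j : H01 D → L2 D) := (wdL D j).continuous
  revert v
  refine forall_of_testPairs (isClosed_eq (by fun_prop) (by fun_prop)) ?_
  intro v hv
  revert w
  refine forall_of_testPairs (isClosed_eq (by fun_prop) (by fun_prop)) ?_
  intro w hw
  obtain ⟨φ, hφ, hφc, hφs, h1, h2⟩ := hv
  obtain ⟨ψ, hψ, hψc, hψs, h3, h4⟩ := hw
  have key := integral_conj_mul_coord_mul_partialDeriv hij hφ hφc hψ
  have hz : ∀ x, x ∉ D → φ x = 0 := fun x hx => image_eq_zero_of_notMem_tsupport fun h => hx (hφs h)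
  have hz' : ∀ x, x ∉ D → ψ x = 0 := fun x hx => image_eq_zero_of_notMem_tsupport fun h => hx (hψs h)
  rw [← setIntegral_eq_integral_of_forall_compl_eq_zero (s := D)
      (f := fun x => starRingEnd ℂ (φ x) * (x i : ℂ) * partialDeriv j ψ x)
      (fun x hx => by simp [hz x hx]),
    ← setIntegral_eq_integral_of_forall_compl_eq_zero (s := D)
      (f := fun x => starRingEnd ℂ (partialDeriv j φ x) * (x i : ℂ) * ψ x)
      (fun x hx => by simp [hz' x hx])] at key
  rw [L2.inner_def, L2.inner_def]
  refine Eq.trans (integral_congr_ae ?_) (key.trans (congrArg Neg.neg (integral_congr_ae ?_)))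
  · filter_upwards [h1, h4 j, coeFn_mulOp (memLp_coord hDb i) (wd j w)] with x e1 e2 e3
    change (fn v) x = _ at e1
    change (wd j w) x = _ at e2
    rw [e3, e1, e2, RCLike.inner_apply]
    ring
  · filter_upwards [h3, h2 j, coeFn_mulOp (memLp_coord hDb i) (fn w)] with x e1 e2 e3
    change (fn w) x = _ at e1
    change (wd j v) x = _ at e2
    rw [e3, e1, e2, RCLike.inner_apply]
    ring

/-- `L_z` is symmetric on `H_0^1`. -/
lemma inner_fn_LzL [d.AtLeastTwo] (hDb : Bornology.IsBounded D) (v w : H01 D) :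
    inner ℂ (fn v) (LzL hDb w) = inner ℂ (LzL hDb v) (fn w) := by
  have h : ∀ u : H01 D, LzL hDb u = (-Complex.I) • (mulOp (memLp_coord hDb 0) (wd 1 u) -
    mulOp (memLp_coord hDb 1) (wd 0 u)) := fun _ => rfl
  rw [h, h, inner_smul_right, inner_smul_left, inner_sub_right, inner_sub_left,
    inner_fn_coord_wd hDb fin_zero_ne_one, inner_fn_coord_wd hDb fin_zero_ne_one.symm,
    inner_mulOp_comm, inner_mulOp_comm]
  simp only [map_neg, Complex.conj_I]
  ring

lemma a0_conj_symm [d.AtLeastTwo] (hDb : Bornology.IsBounded D)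
    {V : EuclideanSpace ℝ (Fin d) → ℝ} (hV : MemLp V ∞ (volume.restrict D)) (Ω : ℝ)
    (v w : H01 D) : starRingEnd ℂ (a0 V Ω w v) = a0 V Ω v w := by
  rw [a0_eq_inner hDb hV, a0_eq_inner hDb hV, inner_a0Op, inner_a0Op, inner_mulOp_comm,
    inner_fn_LzL]
  simp only [map_sub, map_add, map_sum, map_mul, Complex.conj_ofReal, inner_conj_symm]

/-! ### Sobolev embedding `H_0^1 → L^q`, `q ≤ 4` -/

lemma norm_fderiv_le_sum_partialDeriv (φ : EuclideanSpace ℝ (Fin d) → ℂ)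
    (x : EuclideanSpace ℝ (Fin d)) : ‖fderiv ℝ φ x‖ ≤ ∑ j, ‖partialDeriv j φ x‖ := by
  refine ContinuousLinearMap.opNorm_le_bound _ (by positivity) fun v => ?_
  have hv : v = ∑ j, v j • EuclideanSpace.single j (1 : ℝ) := by
    ext i
    simp [Finset.sum_apply, Pi.single_apply]
  conv_lhs => rw [hv]
  rw [map_sum, Finset.sum_mul]
  refine (norm_sum_le _ _).trans (Finset.sum_le_sum fun j _ => ?_)
  rw [map_smul, norm_smul, mul_comm]
  exact mul_le_mul_of_nonneg_left (PiLp.norm_apply_le v j) (norm_nonneg _)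

lemma norm_wd_le_normH01 (j : Fin d) (u : H01 D) : ‖wd j u‖ ≤ normH01 u := by
  refine Real.le_sqrt_of_sq_le ?_
  exact Finset.single_le_sum (f := fun j => ‖wd j u‖ ^ 2) (fun _ _ => by positivity)
    (Finset.mem_univ j)

lemma normH01_nonneg (u : H01 D) : 0 ≤ normH01 u := Real.sqrt_nonneg _

lemma continuous_normH01 : Continuous (normH01 : H01 D → ℝ) := by
  have h : ∀ j, Continuous (wd j : H01 D → L2 D) := fun j => (wdL D j).continuous
  unfold normH01
  fun_prop

/-- The Gagliardo–Nirenberg–Sobolev inequality on test functions, with the exponent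
`p = 4 d / (4 + d)`, whose Sobolev conjugate is `4` and which satisfies `1 ≤ p ≤ 2` since
`d ∈ {2, 3}`. -/
lemma exists_eLpNorm_le_of_testPairs (hd : d = 2 ∨ d = 3)
    (hDb : Bornology.IsBounded D) {q : NNReal} (hq0 : 0 < q) (hq : q ≤ 4) :
    ∃ C : ℝ, 0 ≤ C ∧ ∀ u : H01 D, u.1 ∈ testPairs D →
      eLpNorm (fn u) q (volume.restrict D) ≤ ENNReal.ofReal (C * normH01 u) := by
  have hd0 : (0 : ℝ) < d := by rcases hd with rfl | rfl <;> norm_num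
  set p : NNReal := 4 * d / (4 + d) with hp
  have hpc : (p : ℝ) = 4 * d / (4 + d) := by simp [hp]
  have hp1 : 1 ≤ p := by
    rw [← NNReal.coe_le_coe, hpc]; rcases hd with rfl | rfl <;> norm_num
  have hp2 : p ≤ 2 := by
    rw [← NNReal.coe_le_coe, hpc]; rcases hd with rfl | rfl <;> norm_num
  have hpd : p < Module.finrank ℝ (EuclideanSpace ℝ (Fin d)) := by
    rw [finrank_euclideanSpace_fin, ← NNReal.coe_lt_coe, hpc]
    rcases hd with rfl | rfl <;> norm_num
  have hpq : (p : ℝ)⁻¹ - (Module.finrank ℝ (EuclideanSpace ℝ (Fin d)) : ℝ)⁻¹ ≤ (q : ℝ)⁻¹ := by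
    have h4 : (4 : ℝ)⁻¹ ≤ (q : ℝ)⁻¹ := inv_anti₀ (by exact_mod_cast hq0) (by exact_mod_cast hq)
    refine le_trans (le_of_eq ?_) h4
    rw [finrank_euclideanSpace_fin, hpc]
    field_simp
    ring
  set C1 : NNReal := eLpNormLESNormFDerivOfLeConst ℂ
    (volume : Measure (EuclideanSpace ℝ (Fin d))) D p q
  set C2 : ℝ≥0∞ := (volume.restrict D) Set.univ ^ (1 / (p : ℝ≥0∞).toReal - 1 / (2 : ℝ≥0∞).toReal)
  have hC2 : C2 ≠ ⊤ := by
    refine ENNReal.rpow_ne_top_of_nonneg ?_ ?_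
    · have : (p : ℝ) ≤ 2 := by exact_mod_cast hp2
      have h0 : (0 : ℝ) < p := by positivity
      simp only [ENNReal.coe_toReal, ENNReal.toReal_ofNat, sub_nonneg]
      exact one_div_le_one_div_of_le h0 this
    · rw [Measure.restrict_apply_univ]
      exact hDb.measure_lt_top.ne
  refine ⟨C1 * (d * C2.toReal), by positivity, ?_⟩
  rintro u ⟨φ, hφ, hφc, hφs, h1, h2⟩
  change (fn u : EuclideanSpace ℝ (Fin d) → ℂ) =ᵐ[_] φ at h1
  change ∀ j, (wd j u : EuclideanSpace ℝ (Fin d) → ℂ) =ᵐ[_] _ at h2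
  have hmeas : AEStronglyMeasurable (fderiv ℝ φ) (volume.restrict D) :=
    (hφ.continuous_fderiv (by simp)).aestronglyMeasurable
  have s1 : eLpNorm (fderiv ℝ φ) 2 (volume.restrict D) ≤ d * ENNReal.ofReal (normH01 u) := by
    have e1 : eLpNorm (fderiv ℝ φ) 2 (volume.restrict D) ≤
        eLpNorm (∑ j, fun r => ‖wd j u r‖) 2 (volume.restrict D) := by
      refine eLpNorm_mono_ae_real ?_
      filter_upwards [ae_all_iff.2 h2] with r hr
      simp only [Finset.sum_apply, hr]
      exact norm_fderiv_le_sum_partialDeriv φ r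
    refine e1.trans ((eLpNorm_sum_le (fun j _ => (Lp.aestronglyMeasurable _).norm)
      (by norm_num)).trans ?_)
    have e2 : ∀ j ∈ Finset.univ, eLpNorm (fun r => ‖wd j u r‖) 2 (volume.restrict D) ≤
        ENNReal.ofReal (normH01 u) := by
      intro j _
      rw [eLpNorm_norm, ← Lp.enorm_def, ← ofReal_norm]
      exact ENNReal.ofReal_le_ofReal (norm_wd_le_normH01 j u)
    refine (Finset.sum_le_sum e2).trans ?_
    simp
  calc eLpNorm (fn u) q (volume.restrict D) = eLpNorm φ q (volume.restrict D) :=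
        eLpNorm_congr_ae h1
    _ ≤ eLpNorm φ q volume := eLpNorm_restrict_le _ _ _ _
    _ ≤ C1 * eLpNorm (fderiv ℝ φ) p volume :=
        eLpNorm_le_eLpNorm_fderiv_of_le volume (hφ.of_le (by simp))
          ((subset_tsupport φ).trans hφs) hp1 hpd hpq hDb
    _ = C1 * eLpNorm (fderiv ℝ φ) p (volume.restrict D) := by
        rw [eLpNorm_restrict_eq_of_support_subset (f := fderiv ℝ φ)
          ((support_fderiv_subset ℝ).trans hφs)]
    _ ≤ C1 * (eLpNorm (fderiv ℝ φ) 2 (volume.restrict D) * C2) := by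
        gcongr
        exact eLpNorm_le_eLpNorm_mul_rpow_measure_univ (by exact_mod_cast hp2) hmeas
    _ ≤ C1 * ((d * ENNReal.ofReal (normH01 u)) * C2) := by gcongr
    _ = ENNReal.ofReal (C1 * (d * C2.toReal) * normH01 u) := by
        rw [ENNReal.ofReal_mul (by positivity), ENNReal.ofReal_mul (by positivity),
          ENNReal.ofReal_mul (by positivity), ENNReal.ofReal_toReal hC2]
        simp only [ENNReal.ofReal_coe_nnreal, ENNReal.ofReal_natCast]
        ring

/-- The Sobolev inequality passes from test functions to `H_0^1` by Fatou's lemma. -/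
lemma exists_eLpNorm_le (hd : d = 2 ∨ d = 3)
    (hDb : Bornology.IsBounded D) {q : NNReal} (hq0 : 0 < q) (hq : q ≤ 4) :
    ∃ C : ℝ, 0 ≤ C ∧ ∀ u : H01 D,
      eLpNorm (fn u) q (volume.restrict D) ≤ ENNReal.ofReal (C * normH01 u) := by
  obtain ⟨C, hC, h⟩ := exists_eLpNorm_le_of_testPairs hd hDb hq0 hq
  refine ⟨C, hC, forall_of_testPairs (IsSeqClosed.isClosed ?_) h⟩
  intro w u hw hu
  have hfn : Filter.Tendsto (fun n => fn (w n)) Filter.atTop (nhds (fn u)) :=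
    ((fnL D).continuous.tendsto u).comp hu
  obtain ⟨ns, hns, hae⟩ := (tendstoInMeasure_of_tendsto_Lp hfn).exists_seq_tendsto_ae
  have hlim : Filter.Tendsto (fun n => ENNReal.ofReal (C * normH01 (w (ns n)))) Filter.atTop
      (nhds (ENNReal.ofReal (C * normH01 u))) := by
    refine ENNReal.tendsto_ofReal (Filter.Tendsto.const_mul C ?_)
    exact (continuous_normH01.tendsto u).comp (hu.comp hns.tendsto_atTop)
  refine (Lp.eLpNorm_lim_le_liminf_eLpNorm (fun n => Lp.aestronglyMeasurable (fn (w (ns n)))) _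
    hae).trans ?_
  rw [← hlim.liminf_eq]
  exact Filter.liminf_le_liminf (Filter.Eventually.of_forall fun n => hw (ns n))

/-- The Poincaré inequality on a bounded domain. -/
lemma exists_norm_fn_le (hd : d = 2 ∨ d = 3) (hDb : Bornology.IsBounded D) :
    ∃ C : ℝ, 0 ≤ C ∧ ∀ u : H01 D, ‖fn u‖ ≤ C * normH01 u := by
  obtain ⟨C, hC, h⟩ := exists_eLpNorm_le hd hDb (q := 2) (by norm_num) (by norm_num)
  refine ⟨C, hC, fun u => ?_⟩
  rw [Lp.norm_def]
  exact ENNReal.toReal_le_of_le_ofReal (mul_nonneg hC (normH01_nonneg u)) (h u)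

/-! ### Representation of functionals in the inner product `a₀` -/

/-- Riesz representation with respect to a symmetric coercive operator. -/
lemma exists_inner_apply_eq {E : Type*} [NormedAddCommGroup E] [InnerProductSpace ℂ E]
    [CompleteSpace E] (A : E →L[ℂ] E) (hA : ∀ v w, inner ℂ v (A w) = inner ℂ (A v) w)
    {c : ℝ} (hc : 0 < c) (hcA : ∀ v, c * ‖v‖ ^ 2 ≤ (inner ℂ v (A v)).re) (ℓ : E →L[ℂ] ℂ) :
    ∃ g, ∀ v, inner ℂ g (A v) = ℓ v := by
  have hu : IsUnit A := by
    refine ContinuousLinearMap.isUnit_of_forall_le_norm_inner_map A (c := ⟨c, hc.le⟩) hc fun v => ?_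
    rw [← hA]
    calc ‖v‖ ^ 2 * c = c * ‖v‖ ^ 2 := mul_comm _ _
      _ ≤ _ := hcA v
      _ ≤ _ := Complex.re_le_norm _
  obtain ⟨g, hg⟩ := (ContinuousLinearMap.isUnit_iff_bijective.1 hu).2
    ((InnerProductSpace.toDual ℂ E).symm ℓ)
  refine ⟨g, fun v => ?_⟩
  rw [hA, hg, InnerProductSpace.toDual_symm_apply]

lemma exists_re_inner_apply_eq {E : Type*} [NormedAddCommGroup E] [InnerProductSpace ℂ E]
    [CompleteSpace E] [NormedSpace ℝ E] [IsScalarTower ℝ ℂ E]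
    (A : E →L[ℂ] E) (hA : ∀ v w, inner ℂ v (A w) = inner ℂ (A v) w)
    {c : ℝ} (hc : 0 < c) (hcA : ∀ v, c * ‖v‖ ^ 2 ≤ (inner ℂ v (A v)).re) (ℓ : E →L[ℝ] ℝ) :
    ∃ g, ∀ v, (inner ℂ g (A v)).re = ℓ v := by
  obtain ⟨g, hg⟩ := exists_inner_apply_eq A hA hc hcA (StrongDual.extendRCLike (𝕜 := ℂ) ℓ)
  refine ⟨g, fun v => ?_⟩
  rw [hg]
  exact StrongDual.re_extendRCLike_apply (𝕜 := ℂ) ℓ v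

/-- The real bilinear form `(v, w) ↦ Re ⟪v, A w⟫`. -/
def reForm {E : Type*} [NormedAddCommGroup E] [InnerProductSpace ℂ E] [NormedSpace ℝ E]
    [IsScalarTower ℝ ℂ E] (A : E →L[ℂ] E) : E →ₗ[ℝ] E →ₗ[ℝ] ℝ :=
  LinearMap.mk₂ ℝ (fun v w => (inner ℂ v (A w)).re)
    (fun v w z => by simp only [inner_add_left, Complex.add_re])
    (fun c v w => by
      rw [RCLike.real_smul_eq_coe_smul (K := ℂ) c v, inner_smul_left]
      simp)
    (fun v w z => by simp only [map_add, inner_add_right, Complex.add_re])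
    (fun c v w => by
      rw [RCLike.real_smul_eq_coe_smul (K := ℂ) c w, map_smul, inner_smul_right]
      simp)

section Representation

variable [d.AtLeastTwo]

/-- The real part of `a₀` as a real bilinear form. -/
def a0Re (hDb : Bornology.IsBounded D) {V : EuclideanSpace ℝ (Fin d) → ℝ}
    (hV : MemLp V ∞ (volume.restrict D)) (Ω : ℝ) : H01 D →ₗ[ℝ] H01 D →ₗ[ℝ] ℝ :=
  reForm (E := H01 D) (a0Op hDb hV Ω)

lemma a0Re_apply (hDb : Bornology.IsBounded D) {V : EuclideanSpace ℝ (Fin d) → ℝ}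
    (hV : MemLp V ∞ (volume.restrict D)) (Ω : ℝ) (v w : H01 D) :
    a0Re hDb hV Ω v w = (a0 V Ω v w).re := by
  rw [a0_eq_inner hDb hV]
  rfl

lemma a0Re_comm (hDb : Bornology.IsBounded D) {V : EuclideanSpace ℝ (Fin d) → ℝ}
    (hV : MemLp V ∞ (volume.restrict D)) (Ω : ℝ) (v w : H01 D) :
    a0Re hDb hV Ω v w = a0Re hDb hV Ω w v := by
  rw [a0Re_apply, a0Re_apply, ← a0_conj_symm hDb hV, Complex.conj_re]

lemma exists_abs_a0Re_le (hDb : Bornology.IsBounded D) {V : EuclideanSpace ℝ (Fin d) → ℝ}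
    (hV : MemLp V ∞ (volume.restrict D)) (Ω : ℝ) :
    ∃ a : ℝ, 0 ≤ a ∧ ∀ v w : H01 D, |a0Re hDb hV Ω v w| ≤ a * ‖v‖ * ‖w‖ := by
  obtain ⟨a, ha, h⟩ := (a0Op hDb hV Ω).isBoundedLinearMap.bound
  refine ⟨a, ha.le, fun v w => ?_⟩
  rw [a0Re_apply, a0_eq_inner hDb hV]
  refine (Complex.abs_re_le_norm _).trans
    ((norm_inner_le_norm (𝕜 := ℂ) (E := H01 D) _ _).trans ?_)
  calc ‖v‖ * ‖a0Op hDb hV Ω w‖ ≤ ‖v‖ * (a * ‖w‖) := by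
        gcongr; exact h w
    _ = _ := by ring

/-- Coercivity of `a₀` in the full `H¹` norm. -/
lemma exists_norm_sq_le_a0Re (hd : d = 2 ∨ d = 3) (hDb : Bornology.IsBounded D)
    {V : EuclideanSpace ℝ (Fin d) → ℝ} (hV : MemLp V ∞ (volume.restrict D)) {Ω : ℝ}
    (hVΩ : ∃ K : ℝ, 0 < K ∧ ∀ᵐ r ∂(volume.restrict D),
      (1 + K) / 4 * Ω ^ 2 * ((r 0) ^ 2 + (r 1) ^ 2) ≤ V r) :
    ∃ c : ℝ, 0 < c ∧ ∀ u : H01 D, c * ‖u‖ ^ 2 ≤ a0Re hDb hV Ω u u := by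
  obtain ⟨K, hK, hVK⟩ := hVΩ
  obtain ⟨C, hC, hP⟩ := exists_norm_fn_le (D := D) hd hDb
  refine ⟨K / (1 + K) / (C ^ 2 + 1), by positivity, fun u => ?_⟩
  rw [a0Re_apply]
  refine le_trans ?_ (re_a0_self_ge hDb hV hK hVK u)
  have h1 : ‖u‖ ^ 2 ≤ (C ^ 2 + 1) * normH01 u ^ 2 := by
    rw [norm_sq_eq, ← normH01_sq]
    have := pow_le_pow_left₀ (norm_nonneg _) (hP u) 2
    linarith [mul_pow C (normH01 u) 2]
  rw [div_mul_eq_mul_div, div_le_iff₀ (by positivity), mul_assoc (K / (1 + K)),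
    mul_comm (normH01 u ^ 2)]
  gcongr

lemma exists_a0_eq (hd : d = 2 ∨ d = 3) (hDb : Bornology.IsBounded D)
    {V : EuclideanSpace ℝ (Fin d) → ℝ} (hV : MemLp V ∞ (volume.restrict D)) {Ω : ℝ}
    (hVΩ : ∃ K : ℝ, 0 < K ∧ ∀ᵐ r ∂(volume.restrict D),
      (1 + K) / 4 * Ω ^ 2 * ((r 0) ^ 2 + (r 1) ^ 2) ≤ V r) :
    (∀ ℓ : H01 D →L[ℂ] ℂ, ∃ g : H01 D, ∀ v, a0 V Ω g v = ℓ v) ∧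
      ∀ ℓ : H01 D →L[ℝ] ℝ, ∃ g : H01 D, ∀ v, (a0 V Ω g v).re = ℓ v := by
  obtain ⟨c, hc, hcA⟩ := exists_norm_sq_le_a0Re hd hDb hV hVΩ
  have hA : ∀ v w : H01 D, inner ℂ v (a0Op hDb hV Ω w) = inner ℂ (a0Op hDb hV Ω v) w := by
    intro v w
    rw [← a0_eq_inner hDb hV, ← a0_conj_symm hDb hV, a0_eq_inner hDb hV]
    exact inner_conj_symm (𝕜 := ℂ) (E := H01 D) _ _
  have hcA' : ∀ v : H01 D, c * ‖v‖ ^ 2 ≤ (inner ℂ v (a0Op hDb hV Ω v)).re := hcA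
  simp only [a0_eq_inner hDb hV]
  exact ⟨exists_inner_apply_eq (E := H01 D) _ hA hc hcA',
    exists_re_inner_apply_eq (E := H01 D) _ hA hc hcA'⟩

end Representation

/-! ### Quartic integrals -/

/-- Second-order expansion of `‖·‖⁴`. -/
lemma abs_norm_add_pow_four_sub_le (a b : ℂ) :
    |‖a + b‖ ^ 4 - ‖a‖ ^ 4 - 4 * (‖a‖ ^ 2 * (starRingEnd ℂ a * b).re)| ≤
      8 * (‖a‖ ^ 2 * ‖b‖ ^ 2) + 3 * ‖b‖ ^ 4 := by
  have h1 : ‖a + b‖ ^ 2 = ‖a‖ ^ 2 + 2 * (starRingEnd ℂ a * b).re + ‖b‖ ^ 2 := by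
    rw [← Complex.normSq_eq_norm_sq, ← Complex.normSq_eq_norm_sq, ← Complex.normSq_eq_norm_sq]
    simp [Complex.normSq_apply]
    ring
  have h2 : |(starRingEnd ℂ a * b).re| ≤ ‖a‖ * ‖b‖ := by
    refine (Complex.abs_re_le_norm _).trans ?_
    rw [norm_mul, RCLike.norm_conj]
  have h3 : ‖a + b‖ ^ 4 = (‖a + b‖ ^ 2) ^ 2 := by ring
  rw [h3, h1]
  set t := (starRingEnd ℂ a * b).re
  set x := ‖a‖
  set y := ‖b‖
  have hx : 0 ≤ x := norm_nonneg a
  have hy : 0 ≤ y := norm_nonneg b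
  have e : (x ^ 2 + 2 * t + y ^ 2) ^ 2 - x ^ 4 - 4 * (x ^ 2 * t) =
      4 * t ^ 2 + 2 * (x ^ 2 * y ^ 2) + 4 * t * y ^ 2 + y ^ 4 := by ring
  have ht : t ^ 2 ≤ x ^ 2 * y ^ 2 := by
    rw [← mul_pow, ← sq_abs t]; gcongr
  have h4 : |4 * t * y ^ 2| ≤ 4 * (x * y) * y ^ 2 := by
    rw [abs_mul, abs_mul, abs_of_nonneg (by positivity : (0 : ℝ) ≤ y ^ 2), abs_of_pos (by norm_num)]
    gcongr
  have h5 : 4 * (x * y) * y ^ 2 ≤ 2 * (x ^ 2 * y ^ 2) + 2 * y ^ 4 := by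
    nlinarith [mul_nonneg (sq_nonneg (x - y)) (sq_nonneg y)]
  rw [e, abs_le]
  obtain ⟨h6, h7⟩ := abs_le.1 h4
  have h8 : 0 ≤ x ^ 2 * y ^ 2 := by positivity
  have h9 : 0 ≤ y ^ 4 := by positivity
  constructor <;> nlinarith [sq_nonneg t]

section Holder

variable {X : Type*} [MeasurableSpace X] {μ : Measure X}

lemma integrable_norm_pow_four {f : X → ℂ} (hf : MemLp f 4 μ) :
    Integrable (fun x => ‖f x‖ ^ 4) μ :=
  MemLp.integrable_norm_pow (p := 4) hf (by norm_num)

lemma integrable_sq_mul_sq {f g : X → ℂ} (hf : MemLp f 4 μ) (hg : MemLp g 4 μ) :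
    Integrable (fun x => ‖f x‖ ^ 2 * ‖g x‖ ^ 2) μ := by
  refine ((integrable_norm_pow_four hf).add (integrable_norm_pow_four hg)).mono'
    ((hf.1.norm.pow 2).mul (hg.1.norm.pow 2)) (Filter.Eventually.of_forall fun x => ?_)
  rw [Real.norm_of_nonneg (by positivity), Pi.add_apply]
  nlinarith [sq_nonneg (‖f x‖ ^ 2 - ‖g x‖ ^ 2), sq_nonneg (‖f x‖ ^ 2), sq_nonneg (‖g x‖ ^ 2)]

lemma integrable_cube_mul {f g : X → ℂ} (hf : MemLp f 4 μ) (hg : MemLp g 4 μ) :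
    Integrable (fun x => ‖f x‖ ^ 2 * (‖f x‖ * ‖g x‖)) μ := by
  refine ((integrable_norm_pow_four hf).add (integrable_sq_mul_sq hf hg)).mono'
    ((hf.1.norm.pow 2).mul (hf.1.norm.mul hg.1.norm)) (Filter.Eventually.of_forall fun x => ?_)
  rw [Real.norm_of_nonneg (by positivity), Pi.add_apply]
  nlinarith [mul_nonneg (sq_nonneg ‖f x‖) (sq_nonneg (‖f x‖ - ‖g x‖)),
    mul_nonneg (sq_nonneg ‖f x‖) (sq_nonneg ‖f x‖), mul_nonneg (sq_nonneg ‖f x‖) (sq_nonneg ‖g x‖)]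

/-- The Cauchy–Schwarz inequality, in a form that chains. -/
lemma integral_mul_le_of_sq_le {F G : X → ℝ} (hF0 : ∀ x, 0 ≤ F x) (hG0 : ∀ x, 0 ≤ G x)
    (hFm : AEStronglyMeasurable F μ) (hGm : AEStronglyMeasurable G μ)
    (hF : Integrable (fun x => F x ^ 2) μ) (hG : Integrable (fun x => G x ^ 2) μ)
    {a b : ℝ} (ha : 0 ≤ a) (hb : 0 ≤ b) (hFa : ∫ x, F x ^ 2 ∂μ ≤ a ^ 2)
    (hGb : ∫ x, G x ^ 2 ∂μ ≤ b ^ 2) : ∫ x, F x * G x ∂μ ≤ a * b := by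
  have h := integral_mul_le_Lp_mul_Lq_of_nonneg (μ := μ) Real.HolderConjugate.two_two
    (Filter.Eventually.of_forall hF0) (Filter.Eventually.of_forall hG0)
    (by simpa using (memLp_two_iff_integrable_sq hFm).2 hF)
    (by simpa using (memLp_two_iff_integrable_sq hGm).2 hG)
  simp only [Real.rpow_two, ← Real.sqrt_eq_rpow] at h
  refine h.trans (mul_le_mul ?_ ?_ (Real.sqrt_nonneg _) ha)
  · exact Real.sqrt_le_iff.2 ⟨ha, hFa⟩
  · exact Real.sqrt_le_iff.2 ⟨hb, hGb⟩

lemma integral_sq_mul_sq_le {f g : X → ℂ} (hf : MemLp f 4 μ) (hg : MemLp g 4 μ) {a b : ℝ}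
    (hfa : ∫ x, ‖f x‖ ^ 4 ∂μ ≤ a ^ 4) (hgb : ∫ x, ‖g x‖ ^ 4 ∂μ ≤ b ^ 4) :
    ∫ x, ‖f x‖ ^ 2 * ‖g x‖ ^ 2 ∂μ ≤ a ^ 2 * b ^ 2 := by
  refine integral_mul_le_of_sq_le (F := fun x => ‖f x‖ ^ 2) (G := fun x => ‖g x‖ ^ 2)
    (fun _ => by positivity) (fun _ => by positivity)
    (hf.1.norm.pow 2) (hg.1.norm.pow 2) ?_ ?_ (by positivity) (by positivity) ?_ ?_
  · simpa only [← pow_mul] using integrable_norm_pow_four hf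
  · simpa only [← pow_mul] using integrable_norm_pow_four hg
  · simpa only [← pow_mul] using hfa
  · simpa only [← pow_mul] using hgb

lemma integral_cube_mul_le {f g : X → ℂ} (hf : MemLp f 4 μ) (hg : MemLp g 4 μ) {a b : ℝ}
    (ha : 0 ≤ a) (hb : 0 ≤ b)
    (hfa : ∫ x, ‖f x‖ ^ 4 ∂μ ≤ a ^ 4) (hgb : ∫ x, ‖g x‖ ^ 4 ∂μ ≤ b ^ 4) :
    ∫ x, ‖f x‖ ^ 2 * (‖f x‖ * ‖g x‖) ∂μ ≤ a ^ 3 * b := by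
  have h := integral_mul_le_of_sq_le (μ := μ) (F := fun x => ‖f x‖ ^ 2)
    (G := fun x => ‖f x‖ * ‖g x‖) (a := a ^ 2) (b := a * b)
    (fun _ => by positivity) (fun _ => by positivity)
    (hf.1.norm.pow 2) (hf.1.norm.mul hg.1.norm) ?_ ?_ (by positivity) (by positivity) ?_ ?_
  · exact h.trans (le_of_eq (by ring))
  · simpa only [← pow_mul] using integrable_norm_pow_four hf
  · simpa only [mul_pow] using integrable_sq_mul_sq hf hg
  · simpa only [← pow_mul] using hfa
  · simpa only [mul_pow] using integral_sq_mul_sq_le hf hg hfa hgb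

lemma integral_norm_pow_four_le {f : X → ℂ} {a : ℝ} (ha : 0 ≤ a)
    (hfm : AEStronglyMeasurable f μ) (h : eLpNorm f 4 μ ≤ ENNReal.ofReal a) :
    ∫ x, ‖f x‖ ^ 4 ∂μ ≤ a ^ 4 := by
  have hf : MemLp f 4 μ := ⟨hfm, h.trans_lt ENNReal.ofReal_lt_top⟩
  have e := hf.eLpNorm_eq_integral_rpow_norm (by norm_num) (by norm_num)
  rw [e] at h
  have h1 := (ENNReal.ofReal_le_ofReal_iff ha).1 h
  have e4 : (4 : ℝ≥0∞).toReal = ((4 : ℕ) : ℝ) := by norm_num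
  simp only [e4, Real.rpow_natCast] at h1
  have h0 : 0 ≤ ∫ x, ‖f x‖ ^ 4 ∂μ := integral_nonneg fun _ => by positivity
  have h2 := pow_le_pow_left₀ (by positivity) h1 4
  rwa [Real.rpow_inv_natCast_pow h0 (by norm_num)] at h2

end Holder

/-! ### The energy and its derivative -/

section Energy

lemma normX_nonneg (X : H01 D → H01 D → ℂ) (u : H01 D) : 0 ≤ normX X u := Real.sqrt_nonneg _

/-- The cubic form `∫ |u|² Re (conj u * h)`, a quarter of the derivative of `∫ |u|⁴`. -/
def cubic (u h : H01 D) : ℝ :=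
  ∫ r in D, ‖fn u r‖ ^ 2 * (starRingEnd ℂ (fn u r) * fn h r).re

lemma fn_add_ae (u v : H01 D) :
    fn (u + v) =ᵐ[volume.restrict D] fun r => fn u r + fn v r := Lp.coeFn_add (fn u) (fn v)

lemma fn_smul_ae (c : ℝ) (u : H01 D) :
    fn (c • u) =ᵐ[volume.restrict D] fun r => (c : ℂ) * fn u r := by
  have h : fn (c • u) = c • fn u := rfl
  rw [h]
  filter_upwards [Lp.coeFn_smul c (fn u)] with r hr
  rw [hr, Pi.smul_apply, Complex.real_smul]

lemma cubic_smul (c : ℝ) (u v : H01 D) : cubic u (c • v) = c * cubic u v := by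
  rw [cubic, cubic, ← integral_const_mul]
  refine integral_congr_ae ?_
  filter_upwards [fn_smul_ae c v] with r hr
  rw [hr, mul_left_comm, Complex.re_ofReal_mul]
  ring

variable [d.AtLeastTwo] {V : EuclideanSpace ℝ (Fin d) → ℝ} {Ω S : ℝ}

/-- `S` is a constant of the embedding `H_0^1 → L⁴`, with `H_0^1` normed by `a₀`. -/
def IsSobolevConst (D : Set (EuclideanSpace ℝ (Fin d))) (V : EuclideanSpace ℝ (Fin d) → ℝ)
    (Ω S : ℝ) : Prop :=
  0 ≤ S ∧ ∀ u : H01 D, MemLp (fn u) 4 (volume.restrict D) ∧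
    ∫ r in D, ‖fn u r‖ ^ 4 ≤ (S * normX (a0 V Ω) u) ^ 4

lemma exists_isSobolevConst (hd : d = 2 ∨ d = 3) (hDb : Bornology.IsBounded D)
    (hV : MemLp V ∞ (volume.restrict D))
    (hVΩ : ∃ K : ℝ, 0 < K ∧ ∀ᵐ r ∂(volume.restrict D),
      (1 + K) / 4 * Ω ^ 2 * ((r 0) ^ 2 + (r 1) ^ 2) ≤ V r) :
    ∃ S, IsSobolevConst D V Ω S := by
  obtain ⟨K, hK, hVK⟩ := hVΩ
  obtain ⟨C, hC, hS⟩ := exists_eLpNorm_le (D := D) hd hDb (q := 4) (by norm_num) le_rfl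
  refine ⟨C * Real.sqrt ((1 + K) / K), by positivity, fun u => ?_⟩
  have h1 : normH01 u ≤ Real.sqrt ((1 + K) / K) * normX (a0 V Ω) u := by
    rw [normX, ← Real.sqrt_mul (by positivity)]
    refine Real.le_sqrt_of_sq_le ?_
    have h := re_a0_self_ge hDb hV hK hVK u
    rw [div_mul_eq_mul_div, div_le_iff₀ (by positivity)] at h
    rw [div_mul_eq_mul_div, le_div_iff₀ hK]
    linarith
  have h2 : eLpNorm (fn u) 4 (volume.restrict D) ≤
      ENNReal.ofReal (C * Real.sqrt ((1 + K) / K) * normX (a0 V Ω) u) := by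
    refine (hS u).trans (ENNReal.ofReal_le_ofReal ?_)
    rw [mul_assoc]
    gcongr
  exact ⟨⟨Lp.aestronglyMeasurable _, h2.trans_lt ENNReal.ofReal_lt_top⟩,
    integral_norm_pow_four_le (mul_nonneg (by positivity) (normX_nonneg _ u))
      (Lp.aestronglyMeasurable _) h2⟩

lemma IsSobolevConst.integrable_cubic (hS : IsSobolevConst D V Ω S) (u h : H01 D) :
    Integrable (fun r => ‖fn u r‖ ^ 2 * (starRingEnd ℂ (fn u r) * fn h r).re)
      (volume.restrict D) := by
  have hm : ∀ w : H01 D, AEStronglyMeasurable (fn w) (volume.restrict D) := fun w =>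
    Lp.aestronglyMeasurable _
  refine (integrable_cube_mul (hS.2 u).1 (hS.2 h).1).mono' ?_ (Filter.Eventually.of_forall ?_)
  · exact ((hm u).norm.pow 2).mul
      (Complex.continuous_re.comp_aestronglyMeasurable
        ((Complex.continuous_conj.comp_aestronglyMeasurable (hm u)).mul (hm h)))
  · intro r
    rw [norm_mul, Real.norm_of_nonneg (by positivity)]
    gcongr
    refine (Complex.abs_re_le_norm _).trans ?_
    rw [norm_mul, RCLike.norm_conj]

lemma IsSobolevConst.abs_cubic_le (hS : IsSobolevConst D V Ω S) (u h : H01 D) :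
    |cubic u h| ≤ (S * normX (a0 V Ω) u) ^ 3 * (S * normX (a0 V Ω) h) := by
  refine le_trans ?_ (integral_cube_mul_le (hS.2 u).1 (hS.2 h).1
    (mul_nonneg hS.1 (normX_nonneg _ _)) (mul_nonneg hS.1 (normX_nonneg _ _))
    (hS.2 u).2 (hS.2 h).2)
  rw [cubic, ← Real.norm_eq_abs]
  refine norm_integral_le_of_norm_le (integrable_cube_mul (hS.2 u).1 (hS.2 h).1)
    (Filter.Eventually.of_forall fun r => ?_)
  rw [norm_mul, Real.norm_of_nonneg (by positivity)]
  gcongr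
  refine (Complex.abs_re_le_norm _).trans ?_
  rw [norm_mul, RCLike.norm_conj]

lemma IsSobolevConst.cubic_add (hS : IsSobolevConst D V Ω S) (u v w : H01 D) :
    cubic u (v + w) = cubic u v + cubic u w := by
  rw [cubic, cubic, cubic, ← integral_add (hS.integrable_cubic u v) (hS.integrable_cubic u w)]
  refine integral_congr_ae ?_
  filter_upwards [fn_add_ae v w] with r hr
  rw [hr, mul_add, Complex.add_re, mul_add]

lemma energy_eq (hDb : Bornology.IsBounded D) (hV : MemLp V ∞ (volume.restrict D))
    (hS : IsSobolevConst D V Ω S) (β : ℝ) (u : H01 D) :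
    energy V β Ω u = 1 / 2 * a0Re hDb hV Ω u u + β / 4 * ∫ r in D, ‖fn u r‖ ^ 4 := by
  have hi := integrable_a0_integrand hDb hV Ω u u
  have hi4 := integrable_norm_pow_four (hS.2 u).1
  rw [a0Re_apply]
  have h1 : (a0 V Ω u u).re = ∫ r in D, (∑ j, starRingEnd ℂ (wd j u r) * wd j u r
      + (V r : ℂ) * starRingEnd ℂ (fn u r) * fn u r
      - (Ω : ℂ) * starRingEnd ℂ (fn u r) * Lz u r).re := by
    rw [a0]
    exact (integral_re hi).symm
  have hre : Integrable (fun r => (∑ j, starRingEnd ℂ (wd j u r) * wd j u r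
      + (V r : ℂ) * starRingEnd ℂ (fn u r) * fn u r
      - (Ω : ℂ) * starRingEnd ℂ (fn u r) * Lz u r).re) (volume.restrict D) := hi.re
  rw [h1, ← integral_const_mul, ← integral_const_mul, ← integral_add (hre.const_mul _)
    (hi4.const_mul _), energy]
  congr 1
  ext r
  rw [re_a0_integrand]
  ring

lemma normX_sq (hDb : Bornology.IsBounded D) (hV : MemLp V ∞ (volume.restrict D))
    (hpos : ∀ v, 0 ≤ a0Re hDb hV Ω v v) (u : H01 D) :
    normX (a0 V Ω) u ^ 2 = a0Re hDb hV Ω u u := by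
  have h := hpos u
  rw [a0Re_apply] at h
  rw [normX, Real.sq_sqrt h, a0Re_apply]

/-- Second-order expansion of the energy: after the linear term, only the quadratic term of `a₀`
and a remainder of the quartic part are left. -/
lemma abs_energy_add_sub_le (hDb : Bornology.IsBounded D) (hV : MemLp V ∞ (volume.restrict D))
    (hS : IsSobolevConst D V Ω S) {β : ℝ} (hβ : 0 ≤ β) (u h : H01 D) :
    |energy V β Ω (u + h) - energy V β Ω u - (a0Re hDb hV Ω u h + β * cubic u h)
      - 1 / 2 * a0Re hDb hV Ω h h| ≤
    β / 4 * S ^ 4 * normX (a0 V Ω) h ^ 2 *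
      (8 * normX (a0 V Ω) u ^ 2 + 3 * normX (a0 V Ω) h ^ 2) := by
  rw [energy_eq hDb hV hS, energy_eq hDb hV hS]
  have hquad : a0Re hDb hV Ω (u + h) (u + h) =
      a0Re hDb hV Ω u u + 2 * a0Re hDb hV Ω u h + a0Re hDb hV Ω h h := by
    rw [map_add, map_add, LinearMap.add_apply, LinearMap.add_apply, a0Re_comm hDb hV Ω h u]
    ring
  have hi1 := integrable_norm_pow_four (hS.2 (u + h)).1
  have hi2 := integrable_norm_pow_four (hS.2 u).1
  have hi3 := hS.integrable_cubic u h
  have hi4 := integrable_norm_pow_four (hS.2 h).1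
  have hi5 := integrable_sq_mul_sq (hS.2 u).1 (hS.2 h).1
  have e : ∫ r in D, (‖fn (u + h) r‖ ^ 4 - ‖fn u r‖ ^ 4 -
      4 * (‖fn u r‖ ^ 2 * (starRingEnd ℂ (fn u r) * fn h r).re)) =
      (∫ r in D, ‖fn (u + h) r‖ ^ 4) - (∫ r in D, ‖fn u r‖ ^ 4) - 4 * cubic u h := by
    have hi12 : Integrable (fun r => ‖fn (u + h) r‖ ^ 4 - ‖fn u r‖ ^ 4) (volume.restrict D) :=
      hi1.sub hi2
    rw [integral_sub hi12 (hi3.const_mul 4), integral_sub hi1 hi2, integral_const_mul,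
      cubic]
  have e2 : ∫ r in D, (8 * (‖fn u r‖ ^ 2 * ‖fn h r‖ ^ 2) + 3 * ‖fn h r‖ ^ 4) =
      8 * (∫ r in D, ‖fn u r‖ ^ 2 * ‖fn h r‖ ^ 2) + 3 * ∫ r in D, ‖fn h r‖ ^ 4 := by
    rw [integral_add (hi5.const_mul 8) (hi4.const_mul 3), integral_const_mul, integral_const_mul]
  have key : |(∫ r in D, ‖fn (u + h) r‖ ^ 4) - (∫ r in D, ‖fn u r‖ ^ 4) - 4 * cubic u h| ≤
      8 * (∫ r in D, ‖fn u r‖ ^ 2 * ‖fn h r‖ ^ 2) + 3 * ∫ r in D, ‖fn h r‖ ^ 4 := by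
    have hi54 : Integrable (fun r => 8 * (‖fn u r‖ ^ 2 * ‖fn h r‖ ^ 2) + 3 * ‖fn h r‖ ^ 4)
      (volume.restrict D) := (hi5.const_mul 8).add (hi4.const_mul 3)
    rw [← e, ← e2, ← Real.norm_eq_abs]
    refine norm_integral_le_of_norm_le hi54 ?_
    filter_upwards [fn_add_ae u h] with r hr
    rw [hr]
    exact abs_norm_add_pow_four_sub_le _ _
  have b1 := integral_sq_mul_sq_le (hS.2 u).1 (hS.2 h).1 (hS.2 u).2 (hS.2 h).2
  have b2 := (hS.2 h).2
  have hfin : β / 4 * |(∫ r in D, ‖fn (u + h) r‖ ^ 4) - (∫ r in D, ‖fn u r‖ ^ 4) - 4 * cubic u h|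
      ≤ β / 4 * (8 * ((S * normX (a0 V Ω) u) ^ 2 * (S * normX (a0 V Ω) h) ^ 2) +
        3 * (S * normX (a0 V Ω) h) ^ 4) := by
    gcongr
    linarith
  rw [hquad]
  calc _ = |β / 4 * ((∫ r in D, ‖fn (u + h) r‖ ^ 4) - (∫ r in D, ‖fn u r‖ ^ 4)
          - 4 * cubic u h)| := by
        congr 1; ring
    _ = β / 4 * |(∫ r in D, ‖fn (u + h) r‖ ^ 4) - (∫ r in D, ‖fn u r‖ ^ 4) - 4 * cubic u h| := by
        rw [abs_mul, abs_of_nonneg (by positivity)]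
    _ ≤ _ := hfin
    _ = _ := by ring

lemma fderiv_energy_apply (hDb : Bornology.IsBounded D) (hV : MemLp V ∞ (volume.restrict D))
    (hpos : ∀ v, 0 ≤ a0Re hDb hV Ω v v)
    (hS : IsSobolevConst D V Ω S) {β : ℝ} (hβ : 0 ≤ β) (u h : H01 D) :
    fderiv ℝ (energy V β Ω) u h = a0Re hDb hV Ω u h + β * cubic u h := by
  obtain ⟨a, ha, hab⟩ := exists_abs_a0Re_le hDb hV Ω
  have hN : ∀ w : H01 D, normX (a0 V Ω) w ^ 2 ≤ a * ‖w‖ ^ 2 := fun w => by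
    rw [normX_sq hDb hV hpos]
    exact (le_abs_self _).trans ((hab w w).trans (le_of_eq (by ring)))
  have hN1 : ∀ w : H01 D, normX (a0 V Ω) w ≤ Real.sqrt a * ‖w‖ := fun w => by
    refine abs_le_of_sq_le_sq' ?_ (by positivity) |>.2
    rw [mul_pow, Real.sq_sqrt ha]
    exact hN w
  let l : H01 D →ₗ[ℝ] ℝ :=
    { toFun := fun h => a0Re hDb hV Ω u h + β * cubic u h
      map_add' := fun v w => by rw [map_add, hS.cubic_add]; ring
      map_smul' := fun c v => by
        rw [map_smul, cubic_smul, smul_eq_mul, smul_eq_mul, RingHom.id_apply]; ring }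
  let L : H01 D →L[ℝ] ℝ := l.mkContinuous
    (a * ‖u‖ + β * ((S * normX (a0 V Ω) u) ^ 3 * (S * Real.sqrt a))) (fun h => by
      have h1 := hab u h
      have h2 := hS.abs_cubic_le u h
      have h3 : (S * normX (a0 V Ω) u) ^ 3 * (S * normX (a0 V Ω) h) ≤
          (S * normX (a0 V Ω) u) ^ 3 * (S * (Real.sqrt a * ‖h‖)) := by
        have := mul_nonneg hS.1 (normX_nonneg (a0 V Ω) u)
        have := hS.1
        gcongr
        exact hN1 h
      calc ‖l h‖ ≤ |a0Re hDb hV Ω u h| + |β * cubic u h| := norm_add_le _ _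
        _ ≤ a * ‖u‖ * ‖h‖ + β * ((S * normX (a0 V Ω) u) ^ 3 * (S * (Real.sqrt a * ‖h‖))) := by
          rw [abs_mul, abs_of_nonneg hβ]
          exact add_le_add h1 (mul_le_mul_of_nonneg_left (h2.trans h3) hβ)
        _ = _ := by ring)
  have hL : HasFDerivAt (energy V β Ω) L u := by
    rw [hasFDerivAt_iff_isLittleO_nhds_zero]
    refine Asymptotics.IsBigO.trans_isLittleO (g := fun h : H01 D => ‖h‖ ^ 2) ?_
      (Asymptotics.isLittleO_norm_pow_id one_lt_two)
    refine Asymptotics.IsBigO.of_bound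
      (1 / 2 * a + β / 4 * S ^ 4 * a * (8 * normX (a0 V Ω) u ^ 2 + 3 * a)) ?_
    filter_upwards [Metric.ball_mem_nhds (0 : H01 D) one_pos] with h hh
    rw [mem_ball_zero_iff] at hh
    have h1 := abs_energy_add_sub_le hDb hV hS hβ u h
    have h2 := hN h
    have h3 : a0Re hDb hV Ω h h ≤ a * ‖h‖ ^ 2 := by rw [← normX_sq hDb hV hpos]; exact h2
    have h4 : ‖h‖ ^ 2 ≤ 1 := pow_le_one₀ (norm_nonneg _) hh.le
    have h5 : normX (a0 V Ω) h ^ 2 ≤ a := h2.trans (by nlinarith)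
    have h6 : β / 4 * S ^ 4 * normX (a0 V Ω) h ^ 2 *
        (8 * normX (a0 V Ω) u ^ 2 + 3 * normX (a0 V Ω) h ^ 2) ≤
        β / 4 * S ^ 4 * (a * ‖h‖ ^ 2) * (8 * normX (a0 V Ω) u ^ 2 + 3 * a) := by
      gcongr
    have h7 : L h = a0Re hDb hV Ω u h + β * cubic u h := rfl
    rw [h7, Real.norm_eq_abs, Real.norm_of_nonneg (by positivity)]
    have h8 : ∀ x y : ℝ, |x| ≤ |x - y| + |y| := fun x y => by
      simpa using abs_add_le (x - y) y
    refine (h8 _ (1 / 2 * a0Re hDb hV Ω h h)).trans ?_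
    rw [abs_of_nonneg (mul_nonneg (by norm_num) (hpos h) : 0 ≤ 1 / 2 * a0Re hDb hV Ω h h)]
    calc _ ≤ β / 4 * S ^ 4 * (a * ‖h‖ ^ 2) * (8 * normX (a0 V Ω) u ^ 2 + 3 * a) +
          1 / 2 * (a * ‖h‖ ^ 2) := add_le_add (h1.trans h6) (by gcongr)
      _ = _ := by ring
  rw [hL.fderiv]
  rfl

end Energy

/-! ### The mass sphere -/

lemma fn_retraction_mem {v : H01 D} (hv : 1 ≤ ‖fn v‖) : retraction v ∈ massSphere D := by
  have h : fn (retraction v) = ‖fn v‖⁻¹ • fn v := rfl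
  change ‖fn (retraction v)‖ = 1
  rw [h, norm_smul, norm_inv, norm_norm]
  exact inv_mul_cancel₀ (by linarith)

/-- A step along a direction that is `L²`-orthogonal to a point of the mass sphere does not
decrease the mass. -/
lemma one_le_norm_fn_sub_smul {u p : H01 D} (hu : u ∈ massSphere D)
    (h : (inner ℂ (fn u) (fn p)).re = 0) (α : ℝ) : 1 ≤ ‖fn (u - α • p)‖ := by
  have hu1 : ‖fn u‖ = 1 := hu
  have e : fn (u - α • p) = fn u - (α : ℂ) • fn p := rfl
  have h2 := norm_sub_sq (𝕜 := ℂ) (fn u) ((α : ℂ) • fn p)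
  rw [inner_smul_right, RCLike.re_eq_complex_re, Complex.re_ofReal_mul, h, hu1, ← e] at h2
  nlinarith [sq_nonneg ‖(α : ℂ) • fn p‖, norm_nonneg (fn (u - α • p))]

/-! ### The projected gradient -/

section Gradient

variable [d.AtLeastTwo] {V : EuclideanSpace ℝ (Fin d) → ℝ} {Ω S : ℝ}

/-- The defining property of the Sobolev gradient, with the derivative written out. -/
lemma a0Re_sobolevGrad (hd : d = 2 ∨ d = 3) (hDb : Bornology.IsBounded D)
    (hV : MemLp V ∞ (volume.restrict D))
    (hVΩ : ∃ K : ℝ, 0 < K ∧ ∀ᵐ r ∂(volume.restrict D),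
      (1 + K) / 4 * Ω ^ 2 * ((r 0) ^ 2 + (r 1) ^ 2) ≤ V r)
    (hpos : ∀ v, 0 ≤ a0Re hDb hV Ω v v) (hS : IsSobolevConst D V Ω S) {β : ℝ} (hβ : 0 ≤ β)
    (u h : H01 D) :
    a0Re hDb hV Ω (sobolevGrad (a0 V Ω) (energy V β Ω) u) h =
      a0Re hDb hV Ω u h + β * cubic u h := by
  have hex := (exists_a0_eq hd hDb hV hVΩ).2 (fderiv ℝ (energy V β Ω) u)
  rw [a0Re_apply, sobolevGrad, dif_pos hex, hex.choose_spec h,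
    fderiv_energy_apply hDb hV hpos hS hβ]

lemma a0_solOp (hd : d = 2 ∨ d = 3) (hDb : Bornology.IsBounded D)
    (hV : MemLp V ∞ (volume.restrict D))
    (hVΩ : ∃ K : ℝ, 0 < K ∧ ∀ᵐ r ∂(volume.restrict D),
      (1 + K) / 4 * Ω ^ 2 * ((r 0) ^ 2 + (r 1) ^ 2) ≤ V r) (w : L2 D) (h : H01 D) :
    a0 V Ω (solOp (a0 V Ω) w) h = inner ℂ w (fn h) := by
  have hex : ∃ g : H01 D, ∀ v : H01 D, a0 V Ω g v = inner ℂ w (fn v) :=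
    (exists_a0_eq hd hDb hV hVΩ).1 ((innerSL ℂ w).comp (fnL D))
  rw [solOp, dif_pos hex]
  exact hex.choose_spec h

/-- The solution operator does not vanish on the mass sphere, so that the quotient in the
projection is not a division by zero. -/
lemma a0Re_solOp_pos (hd : d = 2 ∨ d = 3) (hDb : Bornology.IsBounded D)
    (hV : MemLp V ∞ (volume.restrict D))
    (hVΩ : ∃ K : ℝ, 0 < K ∧ ∀ᵐ r ∂(volume.restrict D),
      (1 + K) / 4 * Ω ^ 2 * ((r 0) ^ 2 + (r 1) ^ 2) ≤ V r) {u : H01 D} (hu : u ∈ massSphere D) :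
    0 < a0Re hDb hV Ω (solOp (a0 V Ω) (fn u)) (solOp (a0 V Ω) (fn u)) := by
  obtain ⟨c, hc, hcA⟩ := exists_norm_sq_le_a0Re hd hDb hV hVΩ
  set G := solOp (a0 V Ω) (fn u) with hG
  have hu1 : ‖fn u‖ = 1 := hu
  have h1 : a0Re hDb hV Ω G u = 1 := by
    rw [a0Re_apply, a0_solOp hd hDb hV hVΩ]
    have := inner_self_eq_norm_sq (𝕜 := ℂ) (fn u)
    rw [hu1] at this
    simpa using this
  have h0 : G ≠ 0 := by
    intro h
    rw [h, map_zero, LinearMap.zero_apply] at h1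
    exact zero_ne_one h1
  exact lt_of_lt_of_le (mul_pos hc (pow_pos (norm_pos_iff.2 h0) 2)) (hcA G)

/-- The projected gradient `p` of a gradient `g` at a point of the mass sphere is `L²`-orthogonal
to the point, and `a₀`-orthogonal to `g - p`. -/
lemma tangentProj_spec (hd : d = 2 ∨ d = 3) (hDb : Bornology.IsBounded D)
    (hV : MemLp V ∞ (volume.restrict D))
    (hVΩ : ∃ K : ℝ, 0 < K ∧ ∀ᵐ r ∂(volume.restrict D),
      (1 + K) / 4 * Ω ^ 2 * ((r 0) ^ 2 + (r 1) ^ 2) ≤ V r)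
    (hpos : ∀ v, 0 ≤ a0Re hDb hV Ω v v) {u : H01 D} (hu : u ∈ massSphere D) (g : H01 D) :
    (inner ℂ (fn u) (fn (tangentProj (a0 V Ω) u g))).re = 0 ∧
      a0Re hDb hV Ω g (tangentProj (a0 V Ω) u g) =
        normX (a0 V Ω) (tangentProj (a0 V Ω) u g) ^ 2 ∧
      normX (a0 V Ω) (tangentProj (a0 V Ω) u g) ≤ normX (a0 V Ω) g := by
  have hGpos := a0Re_solOp_pos hd hDb hV hVΩ hu
  have hGs := a0_solOp hd hDb hV hVΩ (fn u) (tangentProj (a0 V Ω) u g)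
  set G := solOp (a0 V Ω) (fn u) with hG
  set t := (a0 V Ω g G).re / normX (a0 V Ω) G ^ 2 with ht
  have hp : tangentProj (a0 V Ω) u g = g - t • G := rfl
  set p := tangentProj (a0 V Ω) u g
  have htG : t * a0Re hDb hV Ω G G = a0Re hDb hV Ω g G := by
    rw [ht, normX_sq hDb hV hpos, ← a0Re_apply hDb hV, div_mul_cancel₀ _ hGpos.ne']
  have hpG : a0Re hDb hV Ω p G = 0 := by
    rw [hp, map_sub, map_smul, LinearMap.sub_apply, LinearMap.smul_apply, smul_eq_mul, htG,
      sub_self]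
  have hg : g = p + t • G := by rw [hp, sub_add_cancel]
  have hGp : a0Re hDb hV Ω G p = 0 := by rw [a0Re_comm, hpG]
  have hgp : a0Re hDb hV Ω g p = a0Re hDb hV Ω p p := by
    conv_lhs => rw [hg]
    rw [map_add, map_smul, LinearMap.add_apply, LinearMap.smul_apply, hGp, smul_zero, add_zero]
  refine ⟨?_, ?_, ?_⟩
  · rw [← hGs, ← a0Re_apply hDb hV, hGp]
  · rw [hgp, normX_sq hDb hV hpos]
  · refine (sq_le_sq₀ (normX_nonneg _ _) (normX_nonneg _ _)).1 ?_
    have hgg : a0Re hDb hV Ω g g = a0Re hDb hV Ω p p + t ^ 2 * a0Re hDb hV Ω G G := by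
      conv_lhs => rw [hg]
      simp only [map_add, map_smul, LinearMap.add_apply, LinearMap.smul_apply, hGp, hpG,
        smul_eq_mul]
      ring
    rw [normX_sq hDb hV hpos, normX_sq hDb hV hpos, hgg]
    exact le_add_of_nonneg_right (mul_nonneg (sq_nonneg t) hGpos.le)

lemma normX_sobolevGrad_le (hd : d = 2 ∨ d = 3) (hDb : Bornology.IsBounded D)
    (hV : MemLp V ∞ (volume.restrict D))
    (hVΩ : ∃ K : ℝ, 0 < K ∧ ∀ᵐ r ∂(volume.restrict D),
      (1 + K) / 4 * Ω ^ 2 * ((r 0) ^ 2 + (r 1) ^ 2) ≤ V r)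
    (hpos : ∀ v, 0 ≤ a0Re hDb hV Ω v v) (hS : IsSobolevConst D V Ω S) {β : ℝ} (hβ : 0 ≤ β)
    (u : H01 D) :
    normX (a0 V Ω) (sobolevGrad (a0 V Ω) (energy V β Ω) u) ≤
      normX (a0 V Ω) u + 2 * (β * S ^ 4 * normX (a0 V Ω) u ^ 3) := by
  set g := sobolevGrad (a0 V Ω) (energy V β Ω) u with hg
  have h1 := a0Re_sobolevGrad hd hDb hV hVΩ hpos hS hβ u g
  rw [← hg, ← normX_sq hDb hV hpos] at h1
  have h2 := (le_abs_self _).trans (hS.abs_cubic_le u g)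
  have h3 : 2 * a0Re hDb hV Ω u g ≤ normX (a0 V Ω) u ^ 2 + normX (a0 V Ω) g ^ 2 := by
    have h := hpos (u - g)
    simp only [map_sub, LinearMap.sub_apply, a0Re_comm hDb hV Ω g u] at h
    rw [normX_sq hDb hV hpos, normX_sq hDb hV hpos]
    linarith
  have h4 := mul_le_mul_of_nonneg_left h2 hβ
  set x := normX (a0 V Ω) u
  set y := normX (a0 V Ω) g
  have hx : 0 ≤ x := normX_nonneg _ _
  have hT : 0 ≤ β * S ^ 4 * x ^ 3 := by have := hS.1; positivity
  have h5 : β * ((S * x) ^ 3 * (S * y)) = β * S ^ 4 * x ^ 3 * y := by ring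
  rw [h5] at h4
  set T := β * S ^ 4 * x ^ 3
  -- The inequality `y² ≤ x² + 2 T y` confines `y` to the interval ending at `x + 2 T`.
  by_contra! hlt
  nlinarith

/-! ### One step of the scheme -/

/-- Normalizing a function of `L²` norm at least one does not increase the energy. -/
lemma energy_retraction_le (hDb : Bornology.IsBounded D) (hV : MemLp V ∞ (volume.restrict D))
    (hpos : ∀ v, 0 ≤ a0Re hDb hV Ω v v) (hS : IsSobolevConst D V Ω S) {β : ℝ} (hβ : 0 ≤ β)
    {v : H01 D} (hv : 1 ≤ ‖fn v‖) :
    energy V β Ω (retraction v) ≤ energy V β Ω v := by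
  rw [retraction]
  set s := ‖fn v‖⁻¹
  have hs0 : 0 ≤ s := by positivity
  have hs1 : s ≤ 1 := inv_le_one_of_one_le₀ hv
  have e : ∫ r in D, ‖fn (s • v) r‖ ^ 4 = s ^ 4 * ∫ r in D, ‖fn v r‖ ^ 4 := by
    rw [← integral_const_mul]
    refine integral_congr_ae ?_
    filter_upwards [fn_smul_ae s v] with r hr
    rw [hr, norm_mul, mul_pow, Complex.norm_real, Real.norm_of_nonneg hs0]
  have hI : 0 ≤ ∫ r in D, ‖fn v r‖ ^ 4 := integral_nonneg fun _ => by positivity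
  rw [energy_eq hDb hV hS, energy_eq hDb hV hS, e, map_smul, map_smul, LinearMap.smul_apply,
    smul_eq_mul, smul_eq_mul, ← mul_assoc]
  have h1 : s * s ≤ 1 := mul_le_one₀ hs1 hs0 hs1
  have h2 : s ^ 4 ≤ 1 := pow_le_one₀ hs0 hs1
  have h3 := mul_le_of_le_one_left (hpos v) h1
  have h4 := mul_le_mul_of_nonneg_left (mul_le_of_le_one_left hI h2)
    (by positivity : 0 ≤ β / 4)
  linarith

/-- Energy decrease in one step, for a step size that is small compared with the size of the
iterate and of its gradient. -/
lemma energy_step_le (hd : d = 2 ∨ d = 3) (hDb : Bornology.IsBounded D)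
    (hV : MemLp V ∞ (volume.restrict D))
    (hVΩ : ∃ K : ℝ, 0 < K ∧ ∀ᵐ r ∂(volume.restrict D),
      (1 + K) / 4 * Ω ^ 2 * ((r 0) ^ 2 + (r 1) ^ 2) ≤ V r)
    (hpos : ∀ v, 0 ≤ a0Re hDb hV Ω v v) (hS : IsSobolevConst D V Ω S) {β : ℝ} (hβ : 0 ≤ β)
    {u : H01 D} (hu : u ∈ massSphere D) {Cu Cg α : ℝ} (hCu : normX (a0 V Ω) u ≤ Cu)
    (hCg : normX (a0 V Ω) (riemGrad (a0 V Ω) (energy V β Ω) u) ≤ Cg) (hα0 : 0 ≤ α) (hα1 : α ≤ 1)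
    (hα : α * (1 / 2 + β / 4 * S ^ 4 * (8 * Cu ^ 2 + 3 * Cg ^ 2)) ≤ 1 / 2) :
    retraction (u - α • riemGrad (a0 V Ω) (energy V β Ω) u) ∈ massSphere D ∧
      α / 2 * normX (a0 V Ω) (riemGrad (a0 V Ω) (energy V β Ω) u) ^ 2 ≤ energy V β Ω u -
        energy V β Ω (retraction (u - α • riemGrad (a0 V Ω) (energy V β Ω) u)) := by
  obtain ⟨h1, h2, -⟩ := tangentProj_spec hd hDb hV hVΩ hpos hu
    (sobolevGrad (a0 V Ω) (energy V β Ω) u)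
  change (inner ℂ (fn u) (fn (riemGrad (a0 V Ω) (energy V β Ω) u))).re = 0 at h1
  change a0Re hDb hV Ω _ (riemGrad (a0 V Ω) (energy V β Ω) u) =
    normX (a0 V Ω) (riemGrad (a0 V Ω) (energy V β Ω) u) ^ 2 at h2
  rw [a0Re_sobolevGrad hd hDb hV hVΩ hpos hS hβ] at h2
  set p := riemGrad (a0 V Ω) (energy V β Ω) u
  have hm := one_le_norm_fn_sub_smul hu h1 α
  refine ⟨fn_retraction_mem hm, ?_⟩
  have hR := energy_retraction_le hDb hV hpos hS hβ hm
  have hE := abs_energy_add_sub_le hDb hV hS hβ u (-α • p)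
  have hN : normX (a0 V Ω) (-α • p) ^ 2 = α ^ 2 * normX (a0 V Ω) p ^ 2 := by
    rw [normX_sq hDb hV hpos, normX_sq hDb hV hpos, map_smul, map_smul, LinearMap.smul_apply,
      smul_eq_mul, smul_eq_mul]
    ring
  have hsub : u + -α • p = u - α • p := by rw [neg_smul, sub_eq_add_neg]
  rw [hsub, cubic_smul, ← normX_sq hDb hV hpos (-α • p), hN, map_smul, smul_eq_mul] at hE
  have hE' := (abs_le.1 hE).2
  have hu0 : 0 ≤ normX (a0 V Ω) u := normX_nonneg _ _
  have hp0 : 0 ≤ normX (a0 V Ω) p := normX_nonneg _ _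
  set x := normX (a0 V Ω) u
  set y := normX (a0 V Ω) p
  have hS0 := hS.1
  have hb : β / 4 * S ^ 4 * (α ^ 2 * y ^ 2) * (8 * x ^ 2 + 3 * (α ^ 2 * y ^ 2)) ≤
      β / 4 * S ^ 4 * (α ^ 2 * y ^ 2) * (8 * Cu ^ 2 + 3 * (1 * Cg ^ 2)) := by
    have : α ^ 2 ≤ 1 := pow_le_one₀ hα0 hα1
    gcongr
  have hc := mul_le_mul_of_nonneg_left hα (by positivity : 0 ≤ α * y ^ 2)
  linear_combination hR + hE' + hb + hc - α * h2

end Gradient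

end GrossPitaevskii

end

theorem theorem3p2 {d : ℕ} [d.AtLeastTwo] (hd : d = 2 ∨ d = 3)
    (D : Set (EuclideanSpace ℝ (Fin d))) (hDo : IsOpen D) (hDb : Bornology.IsBounded D)
    (V : EuclideanSpace ℝ (Fin d) → ℝ) (hV : MemLp V ∞ (volume.restrict D))
    (hV0 : ∀ᵐ r ∂(volume.restrict D), 0 ≤ V r)
    (β Ω : ℝ) (hβ : 0 ≤ β) (hΩ : 0 ≤ Ω)
    (hVΩ : ∃ K : ℝ, 0 < K ∧ ∀ᵐ r ∂(volume.restrict D),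
      (1 + K) / 4 * Ω ^ 2 * ((r 0) ^ 2 + (r 1) ^ 2) ≤ V r)
    (ρ : ℝ) :
    ∃ Cu Cg Cα : ℝ, 0 < Cu ∧ 0 < Cg ∧ 0 < Cα ∧ Cα ≤ 1 ∧
      ∀ (u : ℕ → GrossPitaevskii.H01 D) (α : ℕ → ℝ) (αmin αmax : ℝ),
        u 0 ∈ GrossPitaevskii.massSphere D → GrossPitaevskii.normH01 (u 0) = ρ →
        0 < αmin → (∀ n, αmin ≤ α n ∧ α n ≤ αmax) → αmax ≤ Cα →
        (∀ n, u (n + 1) = GrossPitaevskii.retraction (u n - α n •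
          GrossPitaevskii.riemGrad (GrossPitaevskii.a0 V Ω)
            (GrossPitaevskii.energy V β Ω) (u n))) →
        ∀ n,
          GrossPitaevskii.normX (GrossPitaevskii.a0 V Ω) (u n) ≤ Cu ∧
          GrossPitaevskii.normX (GrossPitaevskii.a0 V Ω)
              (GrossPitaevskii.riemGrad (GrossPitaevskii.a0 V Ω)
                (GrossPitaevskii.energy V β Ω) (u n)) ≤
            GrossPitaevskii.normX (GrossPitaevskii.a0 V Ω)
              (GrossPitaevskii.sobolevGrad (GrossPitaevskii.a0 V Ω)
                (GrossPitaevskii.energy V β Ω) (u n)) ∧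
          GrossPitaevskii.normX (GrossPitaevskii.a0 V Ω)
              (GrossPitaevskii.sobolevGrad (GrossPitaevskii.a0 V Ω)
                (GrossPitaevskii.energy V β Ω) (u n)) ≤ Cg ∧
          αmin / 2 * GrossPitaevskii.normX (GrossPitaevskii.a0 V Ω)
              (GrossPitaevskii.riemGrad (GrossPitaevskii.a0 V Ω)
                (GrossPitaevskii.energy V β Ω) (u n)) ^ 2 ≤
            GrossPitaevskii.energy V β Ω (u n) - GrossPitaevskii.energy V β Ω (u (n + 1)) := by
  open GrossPitaevskii in
  obtain ⟨c, hc, hcA⟩ := exists_norm_sq_le_a0Re hd hDb hV hVΩ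
  have hpos : ∀ v, 0 ≤ a0Re hDb hV Ω v v := fun v => le_trans (by positivity) (hcA v)
  obtain ⟨S, hS⟩ := exists_isSobolevConst hd hDb hV hVΩ
  have hS0 := hS.1
  obtain ⟨a, ha, hab⟩ := exists_abs_a0Re_le hDb hV Ω
  -- `E₀` bounds the energy of an initial value `u₀`, since `‖u₀‖_{a₀}² ≤ a (1 + ρ²)`.
  set N₀ := a * (1 + ρ ^ 2) with hN₀
  set E₀ := 1 / 2 * N₀ + β / 4 * (S ^ 4 * N₀ ^ 2) with hE₀
  have hN₀0 : 0 ≤ N₀ := by positivity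
  have hE₀0 : 0 ≤ E₀ := by positivity
  set Cu := Real.sqrt (2 * E₀) + 1 with hCu
  have hCu0 : 0 < Cu := by positivity
  set Cg := Cu + 2 * (β * S ^ 4 * Cu ^ 3) with hCg
  have hCg0 : 0 < Cg := by positivity
  set M := β / 4 * S ^ 4 * (8 * Cu ^ 2 + 3 * Cg ^ 2) with hM
  have hM0 : 0 ≤ M := by positivity
  refine ⟨Cu, Cg, 1 / (1 + 2 * M), hCu0, hCg0, by positivity,
    (div_le_one (by positivity)).2 (by linarith), ?_⟩
  intro u α αmin αmax hu0 hρ hαmin hα hαmax hrec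
  have hαn : ∀ n, 0 ≤ α n ∧ α n ≤ 1 ∧ α n * (1 / 2 + M) ≤ 1 / 2 := by
    intro n
    have h1 : α n ≤ 1 / (1 + 2 * M) := (hα n).2.trans hαmax
    have h2 := (le_div_iff₀ (by positivity)).1 h1
    have h3 : 0 ≤ α n := hαmin.le.trans (hα n).1
    exact ⟨h3, by nlinarith, by linarith⟩
  have hbound : ∀ v : H01 D, energy V β Ω v ≤ E₀ → normX (a0 V Ω) v ≤ Cu := by
    intro v hv
    have hI : 0 ≤ β / 4 * ∫ r in D, ‖fn v r‖ ^ 4 :=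
      mul_nonneg (by positivity) (integral_nonneg fun _ => by positivity)
    rw [energy_eq hDb hV hS, ← normX_sq hDb hV hpos] at hv
    have : normX (a0 V Ω) v ≤ Real.sqrt (2 * E₀) := Real.le_sqrt_of_sq_le (by linarith)
    linarith
  have hgrad : ∀ v : H01 D, normX (a0 V Ω) v ≤ Cu →
      normX (a0 V Ω) (sobolevGrad (a0 V Ω) (energy V β Ω) v) ≤ Cg := by
    intro v hv
    refine (normX_sobolevGrad_le hd hDb hV hVΩ hpos hS hβ v).trans ?_
    have := normX_nonneg (a0 V Ω) v
    rw [hCg]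
    gcongr
  have hproj : ∀ v ∈ massSphere D, normX (a0 V Ω) (riemGrad (a0 V Ω) (energy V β Ω) v) ≤
      normX (a0 V Ω) (sobolevGrad (a0 V Ω) (energy V β Ω) v) := fun v hv =>
    (tangentProj_spec hd hDb hV hVΩ hpos hv _).2.2
  have hstep : ∀ n, u n ∈ massSphere D → energy V β Ω (u n) ≤ E₀ →
      u (n + 1) ∈ massSphere D ∧
      α n / 2 * normX (a0 V Ω) (riemGrad (a0 V Ω) (energy V β Ω) (u n)) ^ 2 ≤
        energy V β Ω (u n) - energy V β Ω (u (n + 1)) := by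
    intro n hn hEn
    have h1 := hbound _ hEn
    rw [hrec n]
    exact energy_step_le hd hDb hV hVΩ hpos hS hβ hn h1 ((hproj _ hn).trans (hgrad _ h1))
      (hαn n).1 (hαn n).2.1 (hαn n).2.2
  have hinit : energy V β Ω (u 0) ≤ E₀ := by
    have h1 : ‖u 0‖ ^ 2 = 1 + ρ ^ 2 := by
      have h : ‖fn (u 0)‖ = 1 := hu0
      rw [norm_sq_eq, ← normH01_sq, h, hρ, one_pow]
    have h2 : normX (a0 V Ω) (u 0) ^ 2 ≤ N₀ := by
      rw [normX_sq hDb hV hpos, hN₀, ← h1]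
      exact (le_abs_self _).trans ((hab _ _).trans (le_of_eq (by ring)))
    have h3 : ∫ r in D, ‖fn (u 0) r‖ ^ 4 ≤ S ^ 4 * N₀ ^ 2 := by
      refine (hS.2 (u 0)).2.trans ?_
      calc (S * normX (a0 V Ω) (u 0)) ^ 4 = S ^ 4 * (normX (a0 V Ω) (u 0) ^ 2) ^ 2 := by ring
        _ ≤ S ^ 4 * N₀ ^ 2 := by gcongr
    rw [energy_eq hDb hV hS, ← normX_sq hDb hV hpos, hE₀]
    gcongr
  have hind : ∀ n, u n ∈ massSphere D ∧ energy V β Ω (u n) ≤ E₀ := by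
    intro n
    induction n with
    | zero => exact ⟨hu0, hinit⟩
    | succ n ih =>
      obtain ⟨h1, h2⟩ := hstep n ih.1 ih.2
      have h3 := mul_nonneg (div_nonneg (hαn n).1 zero_le_two)
        (sq_nonneg (normX (a0 V Ω) (riemGrad (a0 V Ω) (energy V β Ω) (u n))))
      exact ⟨h1, by linarith [ih.2]⟩
  intro n
  obtain ⟨hn, hEn⟩ := hind n
  refine ⟨hbound _ hEn, hproj _ hn, hgrad _ (hbound _ hEn), ?_⟩
  refine le_trans ?_ (hstep n hn hEn).2
  gcongr
  exact (hα n).1
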